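/- Let $1\le m<n$ be integers, let $G(n,m)$ be the Grassmannian of $m$-dimensional linear subspaces of $\mathbb{R}^n$ with its natural rotation-invariant probability measure, and for $V\in G(n,m)$ let $\pi_V:\mathbb{R}^n\to V$ be orthogonal projection. For bounded $F$ let $N_r(F)$ be the least number of sets of diameter at most $r$ that can cover $F$. For non-empty bounded $F$ let $$\underline{\dim}_B F=\liminf_{r\to0}\frac{\log N_r(F)}{-\log r},\qquad \overline{\dim}_B F=\limsup_{r\to0}\frac{\log N_r(F)}{-\log r}$$ be the lower and upper box dimensions. For non-empty $F$, not necessarily bounded, let $$\dim_P F=\inf\Big\{\sup_j\overline{\dim}_B F_j : F\subseteq\bigcup_{j=1}^\infty F_j,\ F_j\text{ compact}\Big\}$$ be the packing dimension, and let $\dim_A F$ be the Assouad dimension, i.e. the infimum of the $\alpha$ for which there is $C>0$ with $N_r(B(x,R)\cap F)\le C(R/r)^\alpha$ for all $0<r<R$ and all $x\in F$. Suppose that $F\subseteq\mathbb{R}^n$ is non-empty and bounded, that $\overline{\dim}_B F\le m$, and that $$\max\{m,\overline{\dim}_B F\}\ \le\ \dim_A F\ <\ \frac{\big(mn+2\,\overline{\dim}_B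 F\,(n-m)\big)\,m}{mn+\overline{\dim}_B F\,(n-m)}.$$ Then, for almost all $V\in G(n,m)$, $$\overline{\dim}_B\,\pi_V F\ \ge\ \overline{\dim}_B F-\frac{(\dim_A F-m)\,\overline{\dim}_B F}{m}\ >\ \frac{\overline{\dim}_B F}{1+(1/m-1/n)\,\overline{\dim}_B F}.$$ The same statement is true with $\overline{\dim}_B$ replaced by $\underline{\dim}_B$ throughout (in the hypotheses and in the conclusion). If $F$ is a non-empty Borel set (not necessarily bounded), the same statement is true with $\overline{\dim}_B$ replaced by $\dim_P$ throughout. -/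

import Mathlib

open Filter Topology MeasureTheory

noncomputable section

/-! ### Covering numbers and dimensions -/

section Dimensions

variable {X : Type*} [PseudoMetricSpace X]

/-- `N_r(F)`: the least number of sets of diameter at most `r` that can cover `F`.
(It is a genuine minimum for every bounded set in a proper space and every `r > 0`,
see `exists_cover_of_isBounded`.) -/
def coverNum (r : ℝ) (F : Set X) : ℕ :=
  sInf {k : ℕ | ∃ U : Fin k → Set X,
    (∀ i, Metric.ediam (U i) ≤ ENNReal.ofReal r) ∧ F ⊆ ⋃ i, U i}

/-- The minimum defining `coverNum` is taken over a non-empty set for bounded sets. -/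
theorem exists_cover_of_isBounded [ProperSpace X] {F : Set X} (hF : Bornology.IsBounded F)
    {r : ℝ} (hr : 0 < r) :
    {k : ℕ | ∃ U : Fin k → Set X,
      (∀ i, Metric.ediam (U i) ≤ ENNReal.ofReal r) ∧ F ⊆ ⋃ i, U i}.Nonempty := by
  have hF' : TotallyBounded F := hF.isCompact_closure.totallyBounded.subset subset_closure
  obtain ⟨t, ht, hFt⟩ := Metric.totallyBounded_iff.1 hF' (r / 2) (half_pos hr)
  obtain ⟨k, f, -, hf⟩ := ht.fin_param
  refine ⟨k, fun i => Metric.ball (f i) (r / 2), fun i => ?_, fun x hx => ?_⟩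
  · refine Metric.ediam_le fun x hx y hy => ?_
    rw [edist_dist]
    refine ENNReal.ofReal_le_ofReal ?_
    have h1 := Metric.mem_ball.1 hx
    have h2 := Metric.mem_ball.1 hy
    linarith [dist_triangle_right x y (f i)]
  · obtain ⟨y, hy, hxy⟩ := Set.mem_iUnion₂.1 (hFt hx)
    rw [← hf] at hy
    obtain ⟨i, rfl⟩ := hy
    exact Set.mem_iUnion.2 ⟨i, hxy⟩

/-- The upper box-counting dimension of a non-empty bounded set. For such sets in a space of
finite dimension the quotient lies, for small `r`, between `0` and a constant, so that the
real-valued upper and lower limits here and below are the genuine ones. -/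
def upperBoxDim (F : Set X) : ℝ :=
  limsup (fun r : ℝ => Real.log (coverNum r F) / -Real.log r) (𝓝[>] 0)

/-- The lower box-counting dimension of a non-empty bounded set. -/
def lowerBoxDim (F : Set X) : ℝ :=
  liminf (fun r : ℝ => Real.log (coverNum r F) / -Real.log r) (𝓝[>] 0)

/-- The packing dimension of a (not necessarily bounded) non-empty set: the infimum of
`sup_j upperBoxDim (K j)` over all countable covers of `F` by compact sets `K j`. -/
def packingDim (F : Set X) : ℝ :=
  sInf {d : ℝ | ∃ K : ℕ → Set X,
    (∀ j, IsCompact (K j)) ∧ F ⊆ ⋃ j, K j ∧ d = ⨆ j, upperBoxDim (K j)}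

/-- The Assouad dimension of a (not necessarily bounded) non-empty set. -/
def assouadDim (F : Set X) : ℝ :=
  sInf {α : ℝ | ∃ C : ℝ, 0 < C ∧ ∀ r R : ℝ, 0 < r → r < R → ∀ x ∈ F,
    (coverNum r (Metric.closedBall x R ∩ F) : ℝ) ≤ C * (R / r) ^ α}

end Dimensions

/-! ### The Grassmannian and its invariant measure -/

/-- The orthogonal group `O(n)`: the unitary elements of the algebra of linear endomorphisms of
`ℝⁿ`, with the operator norm topology. -/
abbrev OrthGroup (n : ℕ) : Type :=
  unitary (EuclideanSpace ℝ (Fin n) →L[ℝ] EuclideanSpace ℝ (Fin n))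

instance instContinuousStarEnd (n : ℕ) :
    ContinuousStar (EuclideanSpace ℝ (Fin n) →L[ℝ] EuclideanSpace ℝ (Fin n)) :=
  ⟨(ContinuousLinearMap.adjoint (𝕜 := ℝ) (E := EuclideanSpace ℝ (Fin n))
    (F := EuclideanSpace ℝ (Fin n))).continuous⟩

instance instCompactSpaceOrthGroup (n : ℕ) : CompactSpace (OrthGroup n) := by
  refine isCompact_iff_compactSpace.1 (Metric.isCompact_of_isClosed_isBounded ?_ ?_)
  · exact isClosed_unitary
  · refine (Metric.isBounded_closedBall (x := 0) (r := 1)).subset fun u hu => ?_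
    rw [mem_closedBall_zero_iff]
    refine ContinuousLinearMap.opNorm_le_bound _ zero_le_one fun x => ?_
    rw [one_mul]
    exact (Unitary.norm_map ⟨u, hu⟩ x).le

/-- The Haar probability measure of the orthogonal group. -/
def orthHaar (n : ℕ) : Measure (OrthGroup n) := Measure.haarMeasure ⊤

instance instIsProbabilityMeasureOrthHaar (n : ℕ) : IsProbabilityMeasure (orthHaar n) :=
  ⟨by simpa [orthHaar] using Measure.haarMeasure_self (G := OrthGroup n) (K₀ := ⊤)⟩

/-- The Grassmannian `G(n,m)` of `m`-dimensional linear subspaces of `ℝⁿ`. -/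
def Gr (n m : ℕ) : Type :=
  {V : Submodule ℝ (EuclideanSpace ℝ (Fin n)) // Module.finrank ℝ V = m}

/-- The usual topology of `G(n,m)`: that of the metric `d(V, W) = ‖P_V - P_W‖`, where `P_V` is
the orthogonal projection onto `V` viewed as an endomorphism of `ℝⁿ`. -/
instance instTopologicalSpaceGr (n m : ℕ) : TopologicalSpace (Gr n m) :=
  TopologicalSpace.induced (fun V => V.1.starProjection) inferInstance

instance instMeasurableSpaceGr (n m : ℕ) : MeasurableSpace (Gr n m) := borel _

instance instBorelSpaceGr (n m : ℕ) : BorelSpace (Gr n m) := ⟨rfl⟩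

/-- The action of the orthogonal group on the Grassmannian: `g • V` is the image `g(V)`. -/
def Gr.rotate {n m : ℕ} (g : OrthGroup n) (V : Gr n m) : Gr n m :=
  ⟨V.1.map ((Unitary.linearIsometryEquiv g).toLinearEquiv : _ →ₗ[ℝ] _), by
    rw [LinearEquiv.finrank_map_eq]; exact V.2⟩

theorem Gr.starProjection_rotate {n m : ℕ} (g : OrthGroup n) (V : Gr n m) :
    (V.rotate g).1.starProjection = g.1 * V.1.starProjection * (star g).1 := by
  ext1 x
  exact Submodule.starProjection_map_apply (Unitary.linearIsometryEquiv g) V.1 x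

theorem Gr.continuous_rotate_left {n m : ℕ} (V : Gr n m) :
    Continuous fun g : OrthGroup n => V.rotate g := by
  refine continuous_induced_rng.2 ?_
  simp only [Function.comp_def, Gr.starProjection_rotate]
  fun_prop

theorem Gr.continuous_rotate_right {n m : ℕ} (g : OrthGroup n) :
    Continuous fun V : Gr n m => V.rotate g := by
  refine continuous_induced_rng.2 ?_
  simp only [Function.comp_def, Gr.starProjection_rotate]
  exact (continuous_const.mul continuous_induced_dom).mul continuous_const

theorem Gr.rotate_mul {n m : ℕ} (g h : OrthGroup n) (V : Gr n m) :
    V.rotate (g * h) = (V.rotate h).rotate g := by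
  refine Subtype.ext ?_
  simp only [Gr.rotate, ← Submodule.map_comp]
  rfl

/-- The coordinate subspace spanned by the first `m` standard basis vectors of `ℝⁿ`. -/
def Gr.coord {n m : ℕ} (h : m ≤ n) : Gr n m :=
  ⟨Submodule.span ℝ (Set.range fun i : Fin m =>
      EuclideanSpace.basisFun (Fin n) ℝ (Fin.castLE h i)), by
    have h1 := (EuclideanSpace.basisFun (Fin n) ℝ).toBasis.linearIndependent.comp _
      (Fin.castLE_injective h)
    rw [OrthonormalBasis.coe_toBasis] at h1
    exact (finrank_span_eq_card h1).trans (Fintype.card_fin m)⟩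

/-- The natural (rotation invariant) probability measure on `G(n,m)`: the law of `g(V₀)`, where
`V₀` is a coordinate subspace and `g` is a Haar distributed element of the orthogonal group. -/
def grMeasure {n m : ℕ} (h : m ≤ n) : Measure (Gr n m) :=
  (orthHaar n).map fun g => (Gr.coord h).rotate g

instance instIsProbabilityMeasureGrMeasure {n m : ℕ} (h : m ≤ n) :
    IsProbabilityMeasure (grMeasure h) :=
  Measure.isProbabilityMeasure_map (Gr.continuous_rotate_left _).measurable.aemeasurable

theorem map_rotate_grMeasure {n m : ℕ} (h : m ≤ n) (g : OrthGroup n) :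
    (grMeasure h).map (fun V => V.rotate g) = grMeasure h := by
  have h1 : Measurable fun V : Gr n m => V.rotate g := (Gr.continuous_rotate_right g).measurable
  have h2 : Measurable fun u : OrthGroup n => (Gr.coord h).rotate u :=
    (Gr.continuous_rotate_left _).measurable
  have h3 : (orthHaar n).map (fun u => g * u) = orthHaar n := by
    unfold orthHaar; exact map_mul_left_eq_self _ g
  have h4 : Measurable fun u : OrthGroup n => g * u := (continuous_const_mul g).measurable
  unfold grMeasure
  rw [Measure.map_map h1 h2]
  nth_rewrite 2 [← h3]
  rw [Measure.map_map h2 h4]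
  congr 1
  funext u
  exact (Gr.rotate_mul g u _).symm

/-- The image `π_V F ⊆ V` of `F ⊆ ℝⁿ` under the orthogonal projection `π_V : ℝⁿ → V`. -/
def Gr.proj {n m : ℕ} (V : Gr n m) (F : Set (EuclideanSpace ℝ (Fin n))) : Set V.1 :=
  V.1.orthogonalProjectionOnto '' F

end

/-! ### Covering numbers and separated sets. -/

section CoverNum

variable {X Y : Type*} [PseudoMetricSpace X]

/-! Everything follows from a bound of the form `dim (π_V F) ≥ (m / dim_A F) * dim F` for almost all
`V`, which is stronger than the stated one; the strict inequality is algebra and does not involve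
`V`.

For the box dimensions, let `S` be a separated subset of `F` at scale `ρ = 2⁻ᵏ` with `N` points, `N`
being at least a covering number of `F` at a comparable scale. By Cauchy–Schwarz
(`card_sq_le_mul_card_pairs`), `N²` is at most the covering number of `π_V F` times the number of
pairs of `S` projected to within `ρ`. A pair at distance `d` is so projected with probability `O((ρ
/ d) ^ m)`. For `α > dim_A F`, a ball of radius `2 ^ j * ρ` holds at most `min (N, O(2 ^ (j * α)))`
points of `S`, hence `O(2 ^ (j * m) * N ^ (1 - m / α))`. Summing over `O(k)` dyadic scales, the
expected number of close pairs is `O(k * N ^ (2 - m / α))`. The factor `k` is negligible against `ρ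
^ (-ε)`, so summing over `k` gives the covering number at least `N ^ (m / α) * ρ ^ ε`, up to a
constant, for almost every `V`. Then `α → dim_A F`.

For packing dimension, `F` is a continuous image of `ℕ → ℕ`. Restricting to a closed set of
parameters leaves no relatively open piece with small image; the box result is applied to countably
many pieces, and Baire's theorem puts the projection of one of them inside a member of any given
compact cover of `π_V F`. -/

theorem coverNum_le {r : ℝ} {F : Set X} {k : ℕ} {U : Fin k → Set X}
    (hU : ∀ i, Metric.ediam (U i) ≤ ENNReal.ofReal r) (hF : F ⊆ ⋃ i, U i) : coverNum r F ≤ k :=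
  Nat.sInf_le ⟨U, hU, hF⟩

theorem exists_cover_coverNum [ProperSpace X] {F : Set X} (hF : Bornology.IsBounded F) {r : ℝ}
    (hr : 0 < r) : ∃ U : Fin (coverNum r F) → Set X,
      (∀ i, Metric.ediam (U i) ≤ ENNReal.ofReal r) ∧ F ⊆ ⋃ i, U i :=
  Nat.sInf_mem (exists_cover_of_isBounded hF hr)

theorem coverNum_mono [ProperSpace X] {F G : Set X} (hG : Bornology.IsBounded G) (h : F ⊆ G)
    {r : ℝ} (hr : 0 < r) : coverNum r F ≤ coverNum r G := by
  obtain ⟨U, hU, hGU⟩ := exists_cover_coverNum hG hr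
  exact coverNum_le hU (h.trans hGU)

theorem coverNum_anti [ProperSpace X] {F : Set X} (hF : Bornology.IsBounded F)
    {r s : ℝ} (hr : 0 < r) (h : r ≤ s) : coverNum s F ≤ coverNum r F := by
  obtain ⟨U, hU, hFU⟩ := exists_cover_coverNum hF hr
  exact coverNum_le (fun i => (hU i).trans (ENNReal.ofReal_le_ofReal h)) hFU

theorem coverNum_pos [ProperSpace X] {F : Set X} (hF : Bornology.IsBounded F) (hne : F.Nonempty)
    {r : ℝ} (hr : 0 < r) : 0 < coverNum r F := by
  obtain ⟨U, -, hFU⟩ := exists_cover_coverNum hF hr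
  obtain ⟨x, hx⟩ := hne
  obtain ⟨i, -⟩ := Set.mem_iUnion.1 (hFU hx)
  exact i.pos

theorem coverNum_closure [ProperSpace X] {F : Set X} (hF : Bornology.IsBounded F)
    {r : ℝ} (hr : 0 < r) : coverNum r (closure F) = coverNum r F := by
  refine le_antisymm ?_ (coverNum_mono hF.closure subset_closure hr)
  obtain ⟨U, hU, hFU⟩ := exists_cover_coverNum hF hr
  refine coverNum_le (U := fun i => closure (U i)) (fun i => ?_) ?_
  · rw [Metric.ediam_closure]; exact hU i
  · rw [← closure_iUnion_of_finite]
    exact closure_mono hFU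

/-- Cauchy–Schwarz: few sets of diameter at most `r` can only cover many points if many pairs of
these points are within distance `r`. -/
theorem card_sq_le_mul_card_pairs {k : ℕ} {U : Fin k → Set X} {r : ℝ} (hr : 0 ≤ r)
    (hU : ∀ i, Metric.ediam (U i) ≤ ENNReal.ofReal r) (S : Finset Y) (p : Y → X)
    (hS : ∀ y ∈ S, p y ∈ ⋃ i, U i) :
    S.card ^ 2 ≤ k * ((S ×ˢ S).filter fun z => dist (p z.1) (p z.2) ≤ r).card := by
  classical
  rcases S.eq_empty_or_nonempty with rfl | ⟨y₀, hy₀⟩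
  · simp
  have hne : Nonempty (Fin k) := (Set.mem_iUnion.1 (hS y₀ hy₀)).nonempty
  have h1 : ∀ y, ∃ i, y ∈ S → p y ∈ U i := fun y => by
    by_cases hy : y ∈ S
    · obtain ⟨i, hi⟩ := Set.mem_iUnion.1 (hS y hy)
      exact ⟨i, fun _ => hi⟩
    · exact ⟨Classical.arbitrary _, fun h => absurd h hy⟩
  -- The covering sets may overlap. Assigning each point to one of them makes the squares of the
  -- classes disjoint sets of close pairs.
  choose c hc using h1
  have h2 : S.card = ∑ i, (S.filter fun y => c y = i).card :=
    Finset.card_eq_sum_card_fiberwise fun y _ => Finset.mem_coe.2 (Finset.mem_univ _)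
  have h3 : ∑ i, (S.filter fun y => c y = i).card ^ 2 ≤
      ((S ×ˢ S).filter fun z => dist (p z.1) (p z.2) ≤ r).card := by
    have h4 : ∀ i, (S.filter fun y => c y = i).card ^ 2 =
        ((S.filter fun y => c y = i) ×ˢ (S.filter fun y => c y = i)).card := fun i => by
      rw [Finset.card_product, sq]
    simp_rw [h4]
    rw [← Finset.card_biUnion]
    · refine Finset.card_le_card fun z hz => ?_
      simp only [Finset.mem_biUnion, Finset.mem_univ, true_and, Finset.mem_product,
        Finset.mem_filter] at hz ⊢
      obtain ⟨i, ⟨ha, hai⟩, hb, hbi⟩ := hz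
      refine ⟨⟨ha, hb⟩, ?_⟩
      have h5 := (Metric.edist_le_ediam_of_mem (hai ▸ hc _ ha) (hbi ▸ hc _ hb)).trans (hU i)
      rw [edist_dist] at h5
      exact (ENNReal.ofReal_le_ofReal_iff hr).1 h5
    · intro i _ j _ hij
      refine Finset.disjoint_left.2 fun z hz hz' => hij ?_
      simp only [Finset.mem_product, Finset.mem_filter] at hz hz'
      rw [← hz.1.2, hz'.1.2]
  calc S.card ^ 2 = (∑ i, (S.filter fun y => c y = i).card) ^ 2 := by rw [← h2]
    _ ≤ (Finset.univ : Finset (Fin k)).card * ∑ i, (S.filter fun y => c y = i).card ^ 2 :=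
        sq_sum_le_card_mul_sum_sq
    _ ≤ _ := by rw [Finset.card_fin]; exact Nat.mul_le_mul_left _ h3

/-- In a separated set the only close pairs are diagonal, so the Cauchy–Schwarz count reads `card ^
2 ≤ k * card`. -/
theorem card_le_coverNum [ProperSpace X] {F : Set X} (hF : Bornology.IsBounded F) {r : ℝ}
    (hr : 0 < r) {S : Finset X} (hSF : (S : Set X) ⊆ F)
    (hS : (S : Set X).Pairwise fun x y => r < dist x y) : S.card ≤ coverNum r F := by
  classical
  obtain ⟨U, hU, hFU⟩ := exists_cover_coverNum hF hr
  have h1 := card_sq_le_mul_card_pairs hr.le hU S id fun y hy => hFU (hSF hy)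
  have h2 : ((S ×ˢ S).filter fun z => dist (id z.1) (id z.2) ≤ r).card ≤ S.card := by
    refine (Finset.card_le_card (t := S.diag) fun z hz => ?_).trans_eq (Finset.diag_card S)
    simp only [Finset.mem_filter, Finset.mem_product, id, Finset.mem_diag] at hz ⊢
    refine ⟨hz.1.1, by_contra fun h => ?_⟩
    exact absurd hz.2 (not_le.2 (hS hz.1.1 hz.1.2 h))
  rcases S.card.eq_zero_or_pos with h0 | h0
  · omega
  · exact Nat.le_of_mul_le_mul_right (by
      rw [← sq]; exact h1.trans (Nat.mul_le_mul_left _ h2)) h0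

/-- A bounded set contains a finite `r`-separated set that is at least as large as its
`2r`-covering number. -/
theorem exists_separated_coverNum_le [ProperSpace X] {F : Set X} (hF : Bornology.IsBounded F)
    {r : ℝ} (hr : 0 < r) : ∃ S : Finset X, (S : Set X) ⊆ F ∧
      ((S : Set X).Pairwise fun x y => r < dist x y) ∧ coverNum (2 * r) F ≤ S.card := by
  classical
  let A : Set ℕ := {k | ∃ S : Finset X, (S : Set X) ⊆ F ∧
    ((S : Set X).Pairwise fun x y => r < dist x y) ∧ S.card = k}
  have hA : BddAbove A := ⟨coverNum r F, by
    rintro _ ⟨S, h1, h2, rfl⟩; exact card_le_coverNum hF hr h1 h2⟩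
  obtain ⟨S, h1, h2, h3⟩ := Nat.sSup_mem (s := A) ⟨0, ∅, by simp, by simp, rfl⟩ hA
  refine ⟨S, h1, h2, ?_⟩
  -- A separated set of maximal cardinality is an `r`-net: a point far from it could be added.
  have h4 : ∀ x ∈ F, ∃ y ∈ S, dist x y ≤ r := by
    intro x hx
    by_contra! h
    have hxS : x ∉ S := fun hxS => absurd (h x hxS) (by simp [hr.le])
    have h5 : (insert x S).card ∈ A := by
      refine ⟨insert x S, ?_, ?_, rfl⟩
      · rw [Finset.coe_insert]; exact Set.insert_subset hx h1
      · rw [Finset.coe_insert]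
        refine h2.insert fun y hy _ => ⟨h y hy, ?_⟩
        rw [dist_comm]; exact h y hy
    have h6 := le_csSup hA h5
    rw [Finset.card_insert_of_notMem hxS, ← h3] at h6
    omega
  refine coverNum_le (U := fun i => Metric.closedBall (S.equivFin.symm i : X) r) (fun i => ?_) ?_
  · refine Metric.ediam_le fun x hx y hy => ?_
    rw [edist_dist]
    refine ENNReal.ofReal_le_ofReal ?_
    have h1 := Metric.mem_closedBall.1 hx
    have h2 := Metric.mem_closedBall.1 hy
    linarith [dist_triangle_right x y (S.equivFin.symm i : X)]
  · intro x hx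
    obtain ⟨y, hy, hxy⟩ := h4 x hx
    exact Set.mem_iUnion.2 ⟨S.equivFin ⟨y, hy⟩, by simpa using hxy⟩

end CoverNum

/-! ### Polynomial growth of covering numbers. -/

section PolynomialBound

variable {E : Type*} [NormedAddCommGroup E] [NormedSpace ℝ E] [FiniteDimensional ℝ E]

/-- Volume comparison: the balls of radius `r / 4` about an `r / 2`-separated subset are disjoint
and lie in a fixed ball. This bounds the quotients defining the box dimensions. -/
theorem exists_coverNum_le_rpow {F : Set E} (hF : Bornology.IsBounded F) :
    ∃ C : ℝ, 0 < C ∧ ∀ r : ℝ, 0 < r → r < 1 →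
      (coverNum r F : ℝ) ≤ C * r⁻¹ ^ Module.finrank ℝ E := by
  borelize E
  have : ProperSpace E := FiniteDimensional.proper ℝ E
  obtain ⟨R, hR0, hR⟩ : ∃ R : ℝ, 0 < R ∧ F ⊆ Metric.ball 0 R := by
    obtain ⟨R, hR⟩ := hF.subset_ball 0
    exact ⟨max R 1, by positivity, hR.trans (Metric.ball_subset_ball (le_max_left _ _))⟩
  let μ : Measure E := Measure.addHaar
  set d := Module.finrank ℝ E
  refine ⟨(4 * (R + 1)) ^ d, by positivity, fun r hr hr1 => ?_⟩
  obtain ⟨S, hSF, hS, hcard⟩ := exists_separated_coverNum_le hF (half_pos hr)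
  rw [mul_div_cancel₀ _ two_ne_zero] at hcard
  have h1 : μ (⋃ x ∈ S, Metric.ball x (r / 4)) = ∑ x ∈ S, μ (Metric.ball x (r / 4)) := by
    refine measure_biUnion_finset (fun x hx y hy hxy => ?_) fun _ _ => measurableSet_ball
    refine Metric.ball_disjoint_ball ?_
    linarith [hS hx hy hxy]
  have h2 : μ (⋃ x ∈ S, Metric.ball x (r / 4)) ≤ μ (Metric.ball 0 (R + 1)) := by
    refine measure_mono (Set.iUnion₂_subset fun x hx y hy => ?_)
    have h3 := hR (hSF hx)
    rw [Metric.mem_ball] at *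
    linarith [dist_triangle y x 0]
  have hpos : 0 < μ (Metric.ball 0 1) := Metric.measure_ball_pos _ _ one_pos
  have hfin : μ (Metric.ball 0 1) ≠ ⊤ := measure_ball_lt_top.ne
  rw [h1] at h2
  simp_rw [Measure.addHaar_ball_of_pos μ _ (show 0 < r / 4 by positivity)] at h2
  rw [Measure.addHaar_ball_of_pos μ _ (show 0 < R + 1 by positivity), Finset.sum_const, nsmul_eq_mul,
    ← mul_assoc, ENNReal.mul_le_mul_iff_left hpos.ne' hfin, ← ENNReal.ofReal_natCast,
    ← ENNReal.ofReal_mul (by positivity), ENNReal.ofReal_le_ofReal_iff (by positivity)] at h2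
  have h4 : (coverNum r F : ℝ) ≤ S.card := by exact_mod_cast hcard
  refine h4.trans ?_
  rw [← mul_pow, ← div_eq_mul_inv]
  have h5 : (4 * (R + 1) / r) ^ d = (R + 1) ^ d / (r / 4) ^ d := by
    rw [← div_pow]; congr 1; field_simp
  rw [h5, le_div_iff₀ (by positivity)]
  exact h2

end PolynomialBound

/-! ### Box dimensions. -/

section BoxDim

theorem eventually_mem_Ioo_nhdsGT_zero : ∀ᶠ r : ℝ in 𝓝[>] 0, 0 < r ∧ r < 1 :=
  Ioo_mem_nhdsGT one_pos

theorem eventually_neg_le_div_neg_log (c : ℝ) {ε : ℝ} (hε : 0 < ε) :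
    ∀ᶠ r : ℝ in 𝓝[>] 0, -ε < c / -Real.log r ∧ c / -Real.log r < ε := by
  have h1 : Tendsto (fun r : ℝ => c / -Real.log r) (𝓝[>] 0) (𝓝 0) :=
    (tendsto_neg_atBot_atTop.comp Real.tendsto_log_nhdsGT_zero).const_div_atTop c
  exact h1 (Ioo_mem_nhds (neg_lt_zero.2 hε) hε)

theorem log_coverNum_div_nonneg {X : Type*} [PseudoMetricSpace X] (F : Set X) {r : ℝ}
    (hr : 0 < r ∧ r < 1) : 0 ≤ Real.log (coverNum r F) / -Real.log r :=
  div_nonneg (Real.log_natCast_nonneg _) (neg_nonneg.2 (Real.log_nonpos hr.1.le hr.2.le))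

theorem upperBoxDim_nonneg {X : Type*} [PseudoMetricSpace X] (F : Set X) : 0 ≤ upperBoxDim F := by
  -- The real `limsup` is the infimum of the eventual upper bounds, with value `0` if there are
  -- none, so boundedness of the set is not needed.
  refine Real.sInf_nonneg fun a ha => ?_
  obtain ⟨r, hr, hra⟩ := (eventually_mem_Ioo_nhdsGT_zero.and (Filter.eventually_map.1 ha)).exists
  exact (log_coverNum_div_nonneg F hr).trans hra

theorem packingDim_nonneg {X : Type*} [PseudoMetricSpace X] (F : Set X) : 0 ≤ packingDim F := by
  refine Real.sInf_nonneg ?_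
  rintro _ ⟨K, -, -, rfl⟩
  exact Real.iSup_nonneg fun j => upperBoxDim_nonneg _

variable {E E' : Type*} [NormedAddCommGroup E] [NormedSpace ℝ E] [FiniteDimensional ℝ E]
  [NormedAddCommGroup E'] [NormedSpace ℝ E'] [FiniteDimensional ℝ E']

theorem eventually_log_coverNum_div_le {F : Set E} (hF : Bornology.IsBounded F) :
    ∀ᶠ r : ℝ in 𝓝[>] 0,
      Real.log (coverNum r F) / -Real.log r ≤ Module.finrank ℝ E + 1 := by
  obtain ⟨C, hC, h⟩ := exists_coverNum_le_rpow hF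
  filter_upwards [eventually_mem_Ioo_nhdsGT_zero,
    eventually_neg_le_div_neg_log (Real.log C) one_pos] with r hr hr'
  have hlog : 0 < -Real.log r := neg_pos.2 (Real.log_neg hr.1 hr.2)
  rcases (coverNum r F).eq_zero_or_pos with h0 | h0
  · rw [h0]; simp; positivity
  have h1 : Real.log (coverNum r F) ≤ Real.log C + Module.finrank ℝ E * -Real.log r := by
    rw [← Real.log_inv, ← Real.log_pow, ← Real.log_mul hC.ne' (by
      have := hr.1; positivity)]
    exact Real.log_le_log (by exact_mod_cast h0) (h r hr.1 hr.2)
  rw [div_le_iff₀ hlog]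
  have h2 := (div_lt_iff₀ hlog).1 hr'.2
  linarith

theorem isBoundedUnder_le_log_coverNum_div {F : Set E} (hF : Bornology.IsBounded F) :
    (𝓝[>] (0 : ℝ)).IsBoundedUnder (· ≤ ·) fun r => Real.log (coverNum r F) / -Real.log r :=
  ⟨_, Filter.eventually_map.2 (eventually_log_coverNum_div_le hF)⟩

theorem isBoundedUnder_ge_log_coverNum_div {X : Type*} [PseudoMetricSpace X] (F : Set X) :
    (𝓝[>] (0 : ℝ)).IsBoundedUnder (· ≥ ·) fun r => Real.log (coverNum r F) / -Real.log r :=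
  ⟨0, Filter.eventually_map.2
    (eventually_mem_Ioo_nhdsGT_zero.mono fun _ hr => log_coverNum_div_nonneg F hr)⟩

theorem upperBoxDim_le_finrank_add_one {F : Set E} (hF : Bornology.IsBounded F) :
    upperBoxDim F ≤ Module.finrank ℝ E + 1 :=
  limsup_le_of_le (isBoundedUnder_ge_log_coverNum_div F).isCoboundedUnder_le
    (eventually_log_coverNum_div_le hF)

theorem lowerBoxDim_nonneg {F : Set E} (hF : Bornology.IsBounded F) : 0 ≤ lowerBoxDim F :=
  le_liminf_of_le (isBoundedUnder_le_log_coverNum_div hF).isCoboundedUnder_ge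
    (eventually_mem_Ioo_nhdsGT_zero.mono fun _ hr => log_coverNum_div_nonneg F hr)

theorem upperBoxDim_mono {F G : Set E} (hG : Bornology.IsBounded G) (h : F ⊆ G) :
    upperBoxDim F ≤ upperBoxDim G := by
  have : ProperSpace E := FiniteDimensional.proper ℝ E
  refine limsup_le_limsup ?_ (isBoundedUnder_ge_log_coverNum_div F).isCoboundedUnder_le
    (isBoundedUnder_le_log_coverNum_div hG)
  filter_upwards [eventually_mem_Ioo_nhdsGT_zero] with r hr
  refine div_le_div_of_nonneg_right ?_ (neg_nonneg.2 (Real.log_nonpos hr.1.le hr.2.le))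
  rcases (coverNum r F).eq_zero_or_pos with h0 | h0
  · rw [h0]; simpa using Real.log_natCast_nonneg _
  · exact Real.log_le_log (by exact_mod_cast h0) (by exact_mod_cast coverNum_mono hG h hr.1)

theorem upperBoxDim_closure {F : Set E} (hF : Bornology.IsBounded F) :
    upperBoxDim (closure F) = upperBoxDim F := by
  have : ProperSpace E := FiniteDimensional.proper ℝ E
  refine limsup_congr ?_
  filter_upwards [eventually_mem_Ioo_nhdsGT_zero] with r hr
  rw [coverNum_closure hF hr.1]

theorem le_of_forall_sub_mul_le {a b c : ℝ} (hc : 0 < c) (h : ∀ ε > 0, a - c * ε ≤ b) :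
    a ≤ b := by
  refine le_of_forall_pos_le_add fun δ hδ => ?_
  have h1 := h (δ / c) (by positivity)
  rw [mul_div_cancel₀ _ hc.ne'] at h1
  linarith

/-- A power-law comparison of covering numbers, up to `r ^ ε` losses, transfers to the lower and
upper box dimensions. -/
theorem mul_boxDim_le_of_coverNum {F : Set E} {G : Set E'} (hF : Bornology.IsBounded F)
    (hne : F.Nonempty) (hG : Bornology.IsBounded G) {θ : ℝ} (hθ : 0 ≤ θ)
    (h : ∀ ε : ℝ, 0 < ε → ∃ c : ℝ, 0 < c ∧ ∀ r : ℝ, 0 < r → r < 1 →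
      c * r ^ ε * (coverNum r F : ℝ) ^ θ ≤ coverNum r G) :
    θ * upperBoxDim F ≤ upperBoxDim G ∧ θ * lowerBoxDim F ≤ lowerBoxDim G := by
  have : ProperSpace E := FiniteDimensional.proper ℝ E
  -- One `ε` pays for the factor `r ^ ε`, the other for the constant `c`. Approximating the
  -- dimension of `F` costs a further `θ * ε`, whence the `θ + 2` below.
  have key : ∀ ε > 0, ∀ᶠ r : ℝ in 𝓝[>] 0,
      θ * (Real.log (coverNum r F) / -Real.log r) - 2 * ε ≤
        Real.log (coverNum r G) / -Real.log r := by
    intro ε hε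
    obtain ⟨c, hc, hcr⟩ := h ε hε
    filter_upwards [eventually_mem_Ioo_nhdsGT_zero,
      eventually_neg_le_div_neg_log (Real.log c) hε] with r hr hr'
    have hlog : 0 < -Real.log r := neg_pos.2 (Real.log_neg hr.1 hr.2)
    have hr0 := hr.1
    have hN : (0 : ℝ) < coverNum r F := by exact_mod_cast coverNum_pos hF hne hr.1
    have h1 := Real.log_le_log (by positivity) (hcr r hr.1 hr.2)
    rw [Real.log_mul (by positivity) (by positivity), Real.log_mul (by positivity) (by positivity),
      Real.log_rpow hr.1, Real.log_rpow hN] at h1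
    rw [le_div_iff₀ hlog, sub_mul, mul_assoc, div_mul_cancel₀ _ hlog.ne']
    have h2 := (lt_div_iff₀ hlog).1 hr'.1
    linarith
  constructor
  · refine le_of_forall_sub_mul_le (c := θ + 2) (by positivity) fun ε hε => ?_
    have h1 : ∃ᶠ r : ℝ in 𝓝[>] 0,
        upperBoxDim F - ε < Real.log (coverNum r F) / -Real.log r :=
      frequently_lt_of_lt_limsup (isBoundedUnder_ge_log_coverNum_div F).isCoboundedUnder_le
        (sub_lt_self _ hε)
    refine le_limsup_of_frequently_le ((h1.and_eventually (key ε hε)).mono fun r hr => ?_)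
      (isBoundedUnder_le_log_coverNum_div hG)
    have h2 := mul_le_mul_of_nonneg_left hr.1.le hθ
    linarith [hr.2]
  · refine le_of_forall_sub_mul_le (c := θ + 2) (by positivity) fun ε hε => ?_
    have h1 : ∀ᶠ r : ℝ in 𝓝[>] 0,
        lowerBoxDim F - ε < Real.log (coverNum r F) / -Real.log r :=
      eventually_lt_of_lt_liminf (sub_lt_self _ hε) (isBoundedUnder_ge_log_coverNum_div F)
    refine le_liminf_of_le (isBoundedUnder_le_log_coverNum_div hG).isCoboundedUnder_ge ?_
    filter_upwards [h1, key ε hε] with r hr hr'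
    have h2 := mul_le_mul_of_nonneg_left hr.le hθ
    linarith

end BoxDim

/-! ### Probability that a random projection shrinks a vector. -/

section Grassmannian

variable {n m : ℕ}

theorem Gr.continuous_starProjection_apply :
    Continuous fun z : EuclideanSpace ℝ (Fin n) × Gr n m => z.2.1.starProjection z.1 := by
  have h1 : Continuous fun V : Gr n m => V.1.starProjection := continuous_induced_dom
  exact (h1.comp continuous_snd).clm_apply continuous_fst

theorem Gr.isClosed_norm_starProjection_le (x : EuclideanSpace ℝ (Fin n)) (r : ℝ) :
    IsClosed {V : Gr n m | ‖V.1.starProjection x‖ ≤ r} :=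
  isClosed_le ((Gr.continuous_starProjection_apply.comp
    (Continuous.prodMk_right x)).norm) continuous_const

theorem Gr.norm_starProjection_rotate (g : OrthGroup n) (V : Gr n m)
    (x : EuclideanSpace ℝ (Fin n)) :
    ‖(V.rotate g).1.starProjection x‖ = ‖V.1.starProjection ((star g).1 x)‖ := by
  rw [Gr.starProjection_rotate]
  exact Unitary.norm_map g _

theorem OrthGroup.exists_apply_eq {x y : EuclideanSpace ℝ (Fin n)} (h : ‖x‖ = ‖y‖) :
    ∃ g : OrthGroup n, g.1 x = y := by
  refine ⟨Unitary.linearIsometryEquiv.symm (Submodule.reflection (ℝ ∙ (x - y))ᗮ), ?_⟩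
  exact Submodule.reflection_sub h

theorem grMeasure_norm_starProjection_le_congr (h : m ≤ n) {x y : EuclideanSpace ℝ (Fin n)}
    (hxy : ‖x‖ = ‖y‖) (r : ℝ) :
    grMeasure h {V | ‖V.1.starProjection x‖ ≤ r} =
      grMeasure h {V | ‖V.1.starProjection y‖ ≤ r} := by
  obtain ⟨g, rfl⟩ := OrthGroup.exists_apply_eq hxy
  conv_rhs => rw [← map_rotate_grMeasure h g]
  rw [Measure.map_apply (Gr.continuous_rotate_right g).measurable
    (Gr.isClosed_norm_starProjection_le _ _).measurableSet]
  congr 1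
  ext V
  have h1 : (star g).1 (g.1 x) = x := by
    have h2 : (star g).1 * g.1 = 1 := Unitary.coe_star_mul_self g
    exact DFunLike.congr_fun h2 x
  simp only [Set.mem_preimage, Set.mem_ofPred_eq, Gr.norm_starProjection_rotate, h1]

theorem Gr.abs_apply_le_norm_starProjection_coord (h : m ≤ n) (i : Fin m)
    (x : EuclideanSpace ℝ (Fin n)) :
    |x (Fin.castLE h i)| ≤ ‖(Gr.coord h).1.starProjection x‖ := by
  set e := EuclideanSpace.basisFun (Fin n) ℝ (Fin.castLE h i)
  have h1 : (Gr.coord h).1.starProjection e = e :=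
    Submodule.starProjection_eq_self_iff.2 (Submodule.subset_span ⟨i, rfl⟩)
  have h2 : x (Fin.castLE h i) = inner ℝ e ((Gr.coord h).1.starProjection x) := by
    rw [← Submodule.inner_starProjection_left_eq_right, h1,
      ← EuclideanSpace.basisFun_repr, OrthonormalBasis.repr_apply_apply]
  rw [h2]
  refine (abs_real_inner_le_norm _ _).trans ?_
  rw [(EuclideanSpace.basisFun (Fin n) ℝ).norm_eq_one, one_mul]

/-- The set lies in a box with `m` sides of length `2 * r` and `n - m` sides of length `2`. -/
theorem volume_closedBall_inter_norm_starProjection_coord_le (h : m ≤ n) {r : ℝ} (hr : 0 ≤ r) :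
    volume {y : EuclideanSpace ℝ (Fin n) | ‖y‖ ≤ 1 ∧ ‖(Gr.coord h).1.starProjection y‖ ≤ r} ≤
      ENNReal.ofReal (2 ^ n * r ^ m) := by
  let a : Fin n → ℝ := fun i => if (i : ℕ) < m then r else 1
  have h1 : {y : EuclideanSpace ℝ (Fin n) | ‖y‖ ≤ 1 ∧
      ‖(Gr.coord h).1.starProjection y‖ ≤ r} ⊆ WithLp.ofLp ⁻¹' Set.Icc (-a) a := by
    rintro y ⟨hy1, hy2⟩
    have h2 : ∀ i, |y i| ≤ a i := fun i => by
      by_cases hi : (i : ℕ) < m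
      · simp only [a, hi, if_true]
        exact (Gr.abs_apply_le_norm_starProjection_coord h ⟨i, hi⟩ y).trans hy2
      · simp only [a, hi, if_false]
        exact (PiLp.norm_apply_le y i).trans hy1
    exact ⟨fun i => (abs_le.1 (h2 i)).1, fun i => (abs_le.1 (h2 i)).2⟩
  refine (measure_mono h1).trans_eq ?_
  rw [(PiLp.volume_preserving_ofLp (Fin n)).measure_preimage
    measurableSet_Icc.nullMeasurableSet, Real.volume_Icc_pi,
    ← ENNReal.ofReal_prod_of_nonneg]
  · congr 1
    have h3 : ∀ i, a i - (-a) i = 2 * a i := fun i => by simp only [Pi.neg_apply]; ring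
    simp_rw [h3]
    rw [Finset.prod_mul_distrib, Finset.prod_const, Finset.card_univ, Fintype.card_fin]
    congr 1
    simp only [a]
    rw [Finset.prod_ite, Finset.prod_const, Finset.prod_const_one, mul_one]
    congr 1
    rw [Fin.card_filter_val_lt]
    omega
  · intro i _
    have h4 : 0 ≤ a i := by simp only [a]; split_ifs <;> positivity
    simp only [Pi.neg_apply]; linarith

theorem volume_closedBall_inter_norm_starProjection_rotate_le (h : m ≤ n) {r : ℝ} (hr : 0 ≤ r)
    (g : OrthGroup n) :
    volume {y : EuclideanSpace ℝ (Fin n) | ‖y‖ ≤ 1 ∧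
      ‖((Gr.coord h).rotate g).1.starProjection y‖ ≤ r} ≤ ENNReal.ofReal (2 ^ n * r ^ m) := by
  refine le_trans (le_of_eq ?_) (volume_closedBall_inter_norm_starProjection_coord_le h hr)
  rw [← (Unitary.linearIsometryEquiv (star g)).measurePreserving.measure_preimage_emb
    (Unitary.linearIsometryEquiv (star g)).toHomeomorph.measurableEmbedding
    {y | ‖y‖ ≤ 1 ∧ ‖(Gr.coord h).1.starProjection y‖ ≤ r}]
  congr 1
  ext y
  simp only [Set.mem_preimage, Set.mem_ofPred_eq, Gr.norm_starProjection_rotate]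
  rw [LinearIsometryEquiv.norm_map]
  rfl

/-- Fubini for the pairs `(y, V)` with `‖y‖ ≤ 1` and `‖P_V y‖ ≤ r`. For fixed `y`, rotation
invariance replaces `y` by `‖y‖ • x`, which is projected to length at most `r` whenever `x` is. For
fixed `V` the slice is a rotated slab of volume at most `2 ^ n * r ^ m`. -/
theorem volume_mul_grMeasure_le (h : m ≤ n) {x : EuclideanSpace ℝ (Fin n)} (hx : ‖x‖ = 1)
    {r : ℝ} (hr : 0 ≤ r) :
    volume (Metric.closedBall (0 : EuclideanSpace ℝ (Fin n)) 1) *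
      grMeasure h {V | ‖V.1.starProjection x‖ ≤ r} ≤ ENNReal.ofReal (2 ^ n * r ^ m) := by
  set B := Metric.closedBall (0 : EuclideanSpace ℝ (Fin n)) 1
  let T : Set (EuclideanSpace ℝ (Fin n) × Gr n m) := {z | ‖z.2.1.starProjection z.1‖ ≤ r}
  have hT : MeasurableSet T :=
    (isClosed_le Gr.continuous_starProjection_apply.norm continuous_const).measurableSet
  have h1 : volume B * grMeasure h {V | ‖V.1.starProjection x‖ ≤ r} ≤
      ((volume.restrict B).prod (grMeasure h)) T := by
    rw [Measure.prod_apply hT, mul_comm, ← setLIntegral_const]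
    refine setLIntegral_mono' Metric.isClosed_closedBall.measurableSet fun y hy => ?_
    have hy1 : ‖y‖ ≤ 1 := mem_closedBall_zero_iff.1 hy
    have h2 : ‖‖y‖ • x‖ = ‖y‖ := by rw [norm_smul, hx, mul_one, norm_norm]
    have h3 : Prod.mk y ⁻¹' T = {V : Gr n m | ‖V.1.starProjection y‖ ≤ r} := rfl
    rw [h3, ← grMeasure_norm_starProjection_le_congr h h2]
    refine measure_mono fun V hV => ?_
    rw [Set.mem_ofPred_eq] at hV ⊢
    rw [map_smul, norm_smul, norm_norm]
    exact (mul_le_of_le_one_left (norm_nonneg _) hy1).trans hV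
  refine h1.trans ?_
  rw [Measure.prod_apply_symm hT]
  have hmeas : Measurable fun V : Gr n m => (volume.restrict B) ((fun x => (x, V)) ⁻¹' T) :=
    measurable_measure_prodMk_right hT
  unfold grMeasure
  rw [lintegral_map hmeas (Gr.continuous_rotate_left _).measurable]
  calc ∫⁻ g, (volume.restrict B) ((fun x => (x, (Gr.coord h).rotate g)) ⁻¹' T) ∂(orthHaar n)
      ≤ ∫⁻ _, ENNReal.ofReal (2 ^ n * r ^ m) ∂(orthHaar n) := by
        refine lintegral_mono fun g => ?_
        rw [Measure.restrict_apply' Metric.isClosed_closedBall.measurableSet]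
        refine le_trans (measure_mono ?_)
          (volume_closedBall_inter_norm_starProjection_rotate_le h hr g)
        rintro y ⟨hy1, hy2⟩
        exact ⟨mem_closedBall_zero_iff.1 hy2, hy1⟩
    _ = _ := by simp

/-- A random `m`-dimensional projection shrinks a given vector to length at most `r` with
probability `O((r / ‖x‖) ^ m)`. -/
theorem exists_grMeasure_norm_starProjection_le (h : m ≤ n) :
    ∃ C : ℝ, 0 < C ∧ ∀ x : EuclideanSpace ℝ (Fin n), x ≠ 0 → ∀ r : ℝ, 0 ≤ r →
      grMeasure h {V | ‖V.1.starProjection x‖ ≤ r} ≤ ENNReal.ofReal (C * (r / ‖x‖) ^ m) := by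
  set b := volume (Metric.closedBall (0 : EuclideanSpace ℝ (Fin n)) 1)
  have hb0 : b ≠ 0 := (Metric.measure_closedBall_pos _ _ one_pos).ne'
  have hbt : b ≠ ⊤ := measure_closedBall_lt_top.ne
  have hb : 0 < b.toReal := ENNReal.toReal_pos hb0 hbt
  refine ⟨2 ^ n / b.toReal, by positivity, fun x hx r hr => ?_⟩
  have hx' : 0 < ‖x‖ := norm_pos_iff.2 hx
  have h1 : ‖‖x‖⁻¹ • x‖ = 1 := norm_smul_inv_norm hx
  have h2 := volume_mul_grMeasure_le h h1 (r := r / ‖x‖) (by positivity)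
  have h3 : {V : Gr n m | ‖V.1.starProjection (‖x‖⁻¹ • x)‖ ≤ r / ‖x‖} =
      {V | ‖V.1.starProjection x‖ ≤ r} := by
    ext V
    simp only [Set.mem_ofPred_eq]
    rw [map_smul, norm_smul, norm_inv, norm_norm, div_eq_inv_mul,
      mul_le_mul_iff_right₀ (inv_pos.2 hx')]
  rw [h3, mul_comm, ← ENNReal.le_div_iff_mul_le (Or.inl hb0) (Or.inl hbt)] at h2
  refine h2.trans_eq ?_
  rw [div_mul_eq_mul_div, ENNReal.ofReal_div_of_pos hb, ENNReal.ofReal_toReal hbt]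

end Grassmannian

/-! ### Expected number of close pairs after projection. -/

section Energy

variable {n m : ℕ}

/-- The term of the least `j` with `d ≤ 2 ^ j * ρ` suffices: if `j > 0` then `d > 2 ^ (j - 1) * ρ`,
and the factor `2 ^ m` makes up for the missing power of two. -/
theorem inv_pow_le_sum_indicator (m : ℕ) {d ρ : ℝ} (hρ : 0 < ρ) {J : ℕ} (hd : d ≤ 2 ^ J * ρ) :
    (if d ≤ ρ then 1 else (ρ / d) ^ m) ≤ 2 ^ m * ∑ j ∈ Finset.range (J + 1),
      if d ≤ 2 ^ j * ρ then ((2 : ℝ) ^ (j * m))⁻¹ else 0 := by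
  classical
  have hex : ∃ j : ℕ, d ≤ 2 ^ j * ρ := ⟨J, hd⟩
  set j := Nat.find hex with hj
  have hj1 : d ≤ 2 ^ j * ρ := Nat.find_spec hex
  have hjJ : j ≤ J := Nat.find_min' hex hd
  have h1 : ((2 : ℝ) ^ (j * m))⁻¹ ≤ ∑ j ∈ Finset.range (J + 1),
      if d ≤ 2 ^ j * ρ then ((2 : ℝ) ^ (j * m))⁻¹ else 0 := by
    refine le_trans (by rw [if_pos hj1]) (Finset.single_le_sum
      (f := fun j : ℕ => if d ≤ 2 ^ j * ρ then ((2 : ℝ) ^ (j * m))⁻¹ else 0)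
      (fun i _ => ?_) (Finset.mem_range.2 (Nat.lt_succ_of_le hjJ)))
    split_ifs <;> positivity
  refine le_trans ?_ (mul_le_mul_of_nonneg_left h1 (by positivity))
  split_ifs with h
  · have h0 : j = 0 := Nat.le_zero.1 (Nat.find_min' hex (by simpa using h))
    rw [h0]
    simpa using one_le_pow₀ (one_le_two : (1 : ℝ) ≤ 2)
  · obtain ⟨i, hi⟩ : ∃ i, j = i + 1 := by
      refine Nat.exists_eq_succ_of_ne_zero fun h0 => h ?_
      rw [h0] at hj1
      simpa using hj1
    have h2 : 2 ^ i * ρ < d := not_le.1 (Nat.find_min hex (by omega : i < Nat.find hex))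
    have hd0 : 0 < d := hρ.trans (not_le.1 h)
    have h3 : (2 : ℝ) ^ m * ((2 : ℝ) ^ (j * m))⁻¹ = (1 / 2 ^ i) ^ m := by
      rw [hi, pow_mul, pow_succ, mul_pow, mul_inv, mul_comm, mul_assoc,
        inv_mul_cancel₀ (by positivity), mul_one, one_div, inv_pow]
    rw [h3]
    refine pow_le_pow_left₀ (by positivity) ?_ m
    rw [div_le_div_iff₀ hd0 (by positivity), one_mul, mul_comm]
    exact h2.le

/-- Interpolating the trivial bound `N` and the Assouad bound for the number of points of a
separated set in a ball. -/
theorem card_filter_dist_le {F : Set (EuclideanSpace ℝ (Fin n))} (hF : Bornology.IsBounded F)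
    {α C : ℝ} (hC : 0 < C) (hα : 0 < α) (hmα : (m : ℝ) ≤ α)
    (hA : ∀ r R : ℝ, 0 < r → r < R → ∀ x ∈ F,
      (coverNum r (Metric.closedBall x R ∩ F) : ℝ) ≤ C * (R / r) ^ α)
    {ρ : ℝ} (hρ : 0 < ρ) {S : Finset (EuclideanSpace ℝ (Fin n))} (hSF : (S : Set _) ⊆ F)
    (hS : (S : Set (EuclideanSpace ℝ (Fin n))).Pairwise fun x y => ρ / 4 < dist x y)
    {x : EuclideanSpace ℝ (Fin n)} (hx : x ∈ S) (j : ℕ) :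
    ((S.filter fun y => dist x y ≤ 2 ^ j * ρ).card : ℝ) ≤
      C ^ (m / α) * 4 ^ m * 2 ^ (j * m) * (S.card : ℝ) ^ (1 - m / α) := by
  set K := S.filter fun y => dist x y ≤ 2 ^ j * ρ
  have hKS : K ⊆ S := Finset.filter_subset _ _
  have hxK : x ∈ K := Finset.mem_filter.2 ⟨hx, by rw [dist_self]; positivity⟩
  have hK0 : (0 : ℝ) < K.card := by exact_mod_cast Finset.card_pos.2 ⟨x, hxK⟩
  have h1 : (K.card : ℝ) ≤ C * (4 * 2 ^ j) ^ α := by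
    have h2 : K.card ≤ coverNum (ρ / 4) (Metric.closedBall x (2 ^ j * ρ) ∩ F) := by
      refine card_le_coverNum (hF.subset Set.inter_subset_right) (by positivity) ?_
        (hS.mono (Finset.coe_subset.2 hKS))
      intro y hy
      refine ⟨?_, hSF (hKS hy)⟩
      rw [Metric.mem_closedBall, dist_comm]
      exact (Finset.mem_filter.1 hy).2
    have h3 : ρ / 4 < 2 ^ j * ρ := by
      have := one_le_pow₀ (one_le_two : (1 : ℝ) ≤ 2) (n := j)
      nlinarith
    have h4 := hA (ρ / 4) (2 ^ j * ρ) (by positivity) h3 x (hSF hx)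
    have h5 : 2 ^ j * ρ / (ρ / 4) = 4 * 2 ^ j := by field_simp
    rw [h5] at h4
    exact le_trans (by exact_mod_cast h2) h4
  have hθ1 : 0 ≤ m / α := by positivity
  have hθ2 : 0 ≤ 1 - m / α := sub_nonneg.2 ((div_le_one hα).2 hmα)
  have h6 : (C * (4 * 2 ^ j) ^ α) ^ (m / α) = C ^ (m / α) * 4 ^ m * 2 ^ (j * m) := by
    rw [Real.mul_rpow hC.le (by positivity), ← Real.rpow_mul (by positivity),
      mul_div_cancel₀ _ hα.ne', Real.rpow_natCast, mul_pow, pow_mul, mul_assoc]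
  -- The exponent `m / α` turns the Assouad growth `2 ^ (j * α)` into `2 ^ (j * m)`, the reciprocal
  -- of the dyadic weight.
  calc (K.card : ℝ) = (K.card : ℝ) ^ (m / α) * (K.card : ℝ) ^ (1 - m / α) := by
        rw [← Real.rpow_add hK0, add_sub_cancel, Real.rpow_one]
    _ ≤ (C * (4 * 2 ^ j) ^ α) ^ (m / α) * (S.card : ℝ) ^ (1 - m / α) := by
        gcongr
    _ = _ := by rw [h6]

/-- The weight `2 ^ (-j * m)` cancels the growth of the number of points, so all `J + 1` dyadic
scales have the same bound. -/
theorem sum_weight_le {F : Set (EuclideanSpace ℝ (Fin n))} (hF : Bornology.IsBounded F)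
    {α C : ℝ} (hC : 0 < C) (hα : 0 < α) (hmα : (m : ℝ) ≤ α)
    (hA : ∀ r R : ℝ, 0 < r → r < R → ∀ x ∈ F,
      (coverNum r (Metric.closedBall x R ∩ F) : ℝ) ≤ C * (R / r) ^ α)
    {ρ : ℝ} (hρ : 0 < ρ) {S : Finset (EuclideanSpace ℝ (Fin n))} (hSF : (S : Set _) ⊆ F)
    (hS : (S : Set (EuclideanSpace ℝ (Fin n))).Pairwise fun x y => ρ / 4 < dist x y)
    {J : ℕ} (hJ : ∀ x ∈ S, ∀ y ∈ S, dist x y ≤ 2 ^ J * ρ)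
    {x : EuclideanSpace ℝ (Fin n)} (hx : x ∈ S) :
    ∑ y ∈ S, (if dist x y ≤ ρ then 1 else (ρ / dist x y) ^ m) ≤
      2 ^ m * (C ^ (m / α) * 4 ^ m) * (J + 1) * (S.card : ℝ) ^ (1 - m / α) := by
  calc ∑ y ∈ S, (if dist x y ≤ ρ then 1 else (ρ / dist x y) ^ m)
      ≤ ∑ y ∈ S, 2 ^ m * ∑ j ∈ Finset.range (J + 1),
          (if dist x y ≤ 2 ^ j * ρ then ((2 : ℝ) ^ (j * m))⁻¹ else 0) :=
        Finset.sum_le_sum fun y hy => inv_pow_le_sum_indicator m hρ (hJ x hx y hy)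
    _ = 2 ^ m * ∑ j ∈ Finset.range (J + 1),
          ((S.filter fun y => dist x y ≤ 2 ^ j * ρ).card : ℝ) * ((2 : ℝ) ^ (j * m))⁻¹ := by
        rw [← Finset.mul_sum, Finset.sum_comm]
        congr 1
        refine Finset.sum_congr rfl fun j _ => ?_
        rw [← Finset.sum_filter, Finset.sum_const, nsmul_eq_mul]
    _ ≤ 2 ^ m * ∑ j ∈ Finset.range (J + 1),
          C ^ (m / α) * 4 ^ m * (S.card : ℝ) ^ (1 - m / α) := by
        refine mul_le_mul_of_nonneg_left (Finset.sum_le_sum fun j _ => ?_) (by positivity)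
        rw [← div_eq_mul_inv, div_le_iff₀ (by positivity)]
        refine (card_filter_dist_le hF hC hα hmα hA hρ hSF hS hx j).trans_eq ?_
        ring
    _ = _ := by
        rw [Finset.sum_const, Finset.card_range, nsmul_eq_mul]
        push_cast
        ring

theorem Gr.dist_orthogonalProjectionOnto (V : Gr n m) (x y : EuclideanSpace ℝ (Fin n)) :
    dist (V.1.orthogonalProjectionOnto x) (V.1.orthogonalProjectionOnto y) =
      ‖V.1.starProjection (x - y)‖ := by
  rw [dist_eq_norm, ← map_sub]
  rfl

/-- The number of pairs of points of `S` whose projections to `V` are within distance `ρ`. -/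
noncomputable def Gr.closePairs (V : Gr n m) (S : Finset (EuclideanSpace ℝ (Fin n))) (ρ : ℝ) : ℕ :=
  ((S ×ˢ S).filter fun z =>
    dist (V.1.orthogonalProjectionOnto z.1) (V.1.orthogonalProjectionOnto z.2) ≤ ρ).card

theorem Gr.closePairs_eq_sum (V : Gr n m) (S : Finset (EuclideanSpace ℝ (Fin n))) (ρ : ℝ) :
    (V.closePairs S ρ : ENNReal) = ∑ x ∈ S, ∑ y ∈ S,
      {V : Gr n m | ‖V.1.starProjection (x - y)‖ ≤ ρ}.indicator 1 V := by
  rw [Gr.closePairs, Finset.card_filter, Finset.sum_product]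
  push_cast
  refine Finset.sum_congr rfl fun x _ => Finset.sum_congr rfl fun y _ => ?_
  rw [Gr.dist_orthogonalProjectionOnto]
  rfl

theorem Gr.measurable_closePairs (S : Finset (EuclideanSpace ℝ (Fin n))) (ρ : ℝ) :
    Measurable fun V : Gr n m => (V.closePairs S ρ : ENNReal) := by
  simp_rw [Gr.closePairs_eq_sum]
  exact Finset.measurable_fun_sum _ fun x _ => Finset.measurable_fun_sum _ fun y _ =>
    measurable_one.indicator (Gr.isClosed_norm_starProjection_le _ _).measurableSet

theorem exists_lintegral_closePairs_le (h : m ≤ n)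
    {F : Set (EuclideanSpace ℝ (Fin n))} (hF : Bornology.IsBounded F)
    {α C : ℝ} (hC : 0 < C) (hα : 0 < α) (hmα : (m : ℝ) ≤ α)
    (hA : ∀ r R : ℝ, 0 < r → r < R → ∀ x ∈ F,
      (coverNum r (Metric.closedBall x R ∩ F) : ℝ) ≤ C * (R / r) ^ α) :
    ∃ D : ℝ, 0 < D ∧ ∀ ρ : ℝ, 0 < ρ → ∀ S : Finset (EuclideanSpace ℝ (Fin n)),
      (S : Set _) ⊆ F → S.Nonempty →
      ((S : Set (EuclideanSpace ℝ (Fin n))).Pairwise fun x y => ρ / 4 < dist x y) →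
      ∀ J : ℕ, (∀ x ∈ S, ∀ y ∈ S, dist x y ≤ 2 ^ J * ρ) →
      ∫⁻ V, (Gr.closePairs V S ρ : ENNReal) ∂(grMeasure h) ≤
        ENNReal.ofReal (D * (J + 1) * (S.card : ℝ) ^ (2 - m / α)) := by
  obtain ⟨C₁, hC₁, hgr⟩ := exists_grMeasure_norm_starProjection_le h
  -- The constant `C₁ + 1` dominates both `C₁`, for distant pairs, and the trivial probability bound
  -- `1`, for pairs within `ρ`.
  refine ⟨(C₁ + 1) * (2 ^ m * (C ^ (m / α) * 4 ^ m)), by positivity,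
    fun ρ hρ S hSF hne hS J hJ => ?_⟩
  have hmeas : ∀ x y : EuclideanSpace ℝ (Fin n),
      MeasurableSet {V : Gr n m | ‖V.1.starProjection (x - y)‖ ≤ ρ} := fun x y =>
    (Gr.isClosed_norm_starProjection_le _ _).measurableSet
  have h0 : ∀ x y : EuclideanSpace ℝ (Fin n),
      (0 : ℝ) ≤ if dist x y ≤ ρ then 1 else (ρ / dist x y) ^ m := fun x y => by
    split_ifs <;> positivity
  have h1 : ∀ x y, grMeasure h {V | ‖V.1.starProjection (x - y)‖ ≤ ρ} ≤
      ENNReal.ofReal ((C₁ + 1) * if dist x y ≤ ρ then 1 else (ρ / dist x y) ^ m) := by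
    intro x y
    split_ifs with hxy
    · refine prob_le_one.trans ?_
      rw [← ENNReal.ofReal_one]
      exact ENNReal.ofReal_le_ofReal (by linarith)
    · have hne : x - y ≠ 0 := fun h => hxy (by rw [dist_eq_norm, h, norm_zero]; exact hρ.le)
      refine (hgr _ hne ρ hρ.le).trans (ENNReal.ofReal_le_ofReal ?_)
      rw [dist_eq_norm]
      gcongr
      linarith
  simp_rw [Gr.closePairs_eq_sum]
  rw [lintegral_finsetSum _ fun x _ => Finset.measurable_fun_sum _ fun y _ =>
    measurable_one.indicator (hmeas x y)]
  have hN : (0 : ℝ) < S.card := by exact_mod_cast hne.card_pos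
  calc ∑ x ∈ S, ∫⁻ V, ∑ y ∈ S,
        {V : Gr n m | ‖V.1.starProjection (x - y)‖ ≤ ρ}.indicator 1 V ∂(grMeasure h)
      ≤ ∑ x ∈ S, ENNReal.ofReal ((C₁ + 1) * (2 ^ m * (C ^ (m / α) * 4 ^ m) * (J + 1) *
          (S.card : ℝ) ^ (1 - m / α))) := by
        refine Finset.sum_le_sum fun x hx => ?_
        rw [lintegral_finsetSum _ fun y _ => measurable_one.indicator (hmeas x y)]
        simp_rw [lintegral_indicator_one (hmeas _ _)]
        refine (Finset.sum_le_sum fun y _ => h1 x y).trans ?_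
        rw [← ENNReal.ofReal_sum_of_nonneg fun y _ => mul_nonneg (by positivity) (h0 x y),
          ← Finset.mul_sum]
        exact ENNReal.ofReal_le_ofReal (mul_le_mul_of_nonneg_left
          (sum_weight_le hF hC hα hmα hA hρ hSF hS hJ hx) (by positivity))
    _ = _ := by
        rw [Finset.sum_const, nsmul_eq_mul, ← ENNReal.ofReal_natCast,
          ← ENNReal.ofReal_mul (by positivity)]
        congr 1
        have h2 : (S.card : ℝ) ^ (2 - m / α) = S.card * (S.card : ℝ) ^ (1 - m / α) := by
          rw [← Real.rpow_one_add' hN.le]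
          · congr 1; ring
          · have : m / α ≤ 1 := (div_le_one hα).2 hmα
            intro h; linarith
        rw [h2]
        ring

end Energy

/-! ### Almost sure lower bounds for box dimensions of projections. -/

section Projections

variable {n m : ℕ}

theorem Gr.isBounded_proj (V : Gr n m) {F : Set (EuclideanSpace ℝ (Fin n))}
    (hF : Bornology.IsBounded F) : Bornology.IsBounded (V.proj F) :=
  V.1.orthogonalProjectionOnto.lipschitz.isBounded_image hF

theorem Gr.card_sq_le_coverNum_proj (V : Gr n m) {F : Set (EuclideanSpace ℝ (Fin n))}
    (hF : Bornology.IsBounded F) {ρ : ℝ} (hρ : 0 < ρ)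
    {S : Finset (EuclideanSpace ℝ (Fin n))} (hSF : (S : Set _) ⊆ F) :
    S.card ^ 2 ≤ coverNum ρ (V.proj F) * V.closePairs S ρ := by
  obtain ⟨U, hU, hFU⟩ := exists_cover_coverNum (V.isBounded_proj hF) hρ
  exact card_sq_le_mul_card_pairs hρ.le hU S V.1.orthogonalProjectionOnto
    fun y hy => hFU ⟨y, hSF hy, rfl⟩

/-- At the scales `2⁻ᵏ`, almost every projection of a set of points satisfying an Assouad bound
has few close pairs. -/
theorem ae_exists_closePairs_le (h : m ≤ n)
    {F : Set (EuclideanSpace ℝ (Fin n))} (hF : Bornology.IsBounded F)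
    {α C : ℝ} (hC : 0 < C) (hα : 0 < α) (hmα : (m : ℝ) ≤ α)
    (hA : ∀ r R : ℝ, 0 < r → r < R → ∀ x ∈ F,
      (coverNum r (Metric.closedBall x R ∩ F) : ℝ) ≤ C * (R / r) ^ α)
    {S : ℕ → Finset (EuclideanSpace ℝ (Fin n))} (hSF : ∀ k, (S k : Set _) ⊆ F)
    (hne : ∀ k, (S k).Nonempty)
    (hS : ∀ k, (S k : Set (EuclideanSpace ℝ (Fin n))).Pairwise
      fun x y => (1 / 2 : ℝ) ^ k / 4 < dist x y) {ε : ℝ} (hε : 0 < ε) :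
    ∀ᵐ V ∂(grMeasure h), ∃ c : ℝ, 0 < c ∧ ∀ k,
      (Gr.closePairs V (S k) ((1 / 2) ^ k) : ℝ) * ((1 / 2) ^ k) ^ ε ≤
        c * ((S k).card : ℝ) ^ (2 - m / α) := by
  obtain ⟨D, hD, hE⟩ := exists_lintegral_closePairs_le h hF hC hα hmα hA
  -- At scale `2⁻ᵏ` the set `F` then spans `J = k + L` dyadic steps, a loss only linear in `k`.
  obtain ⟨L, hL⟩ : ∃ L : ℕ, ∀ x ∈ F, ∀ y ∈ F, dist x y ≤ 2 ^ L := by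
    obtain ⟨R, hR⟩ := Metric.isBounded_iff.1 hF
    obtain ⟨L, hL⟩ := pow_unbounded_of_one_lt R (one_lt_two : (1 : ℝ) < 2)
    exact ⟨L, fun x hx y hy => (hR hx hy).trans hL.le⟩
  set q : ℝ := (1 / 2) ^ ε with hq
  have hq0 : 0 < q := by positivity
  have hq1 : q < 1 := Real.rpow_lt_one (by norm_num) (by norm_num) hε
  have hqk : ∀ k : ℕ, (((1 : ℝ) / 2) ^ k) ^ ε = q ^ k := fun k => by
    rw [hq, ← Real.rpow_natCast, ← Real.rpow_natCast, ← Real.rpow_mul (by norm_num),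
      ← Real.rpow_mul (by norm_num), mul_comm]
  have hN : ∀ k, (0 : ℝ) < ((S k).card : ℝ) ^ (2 - m / α) := fun k =>
    Real.rpow_pos_of_pos (by exact_mod_cast (hne k).card_pos) _
  -- The normalised pair count has integral at most `D * (k + L + 1) * q ^ k`. This is summable, so
  -- for almost every `V` the series converges and its sum bounds each term.
  let g : ℕ → Gr n m → ENNReal := fun k V =>
    (Gr.closePairs V (S k) ((1 / 2) ^ k) : ENNReal) *
      ENNReal.ofReal (q ^ k / ((S k).card : ℝ) ^ (2 - m / α))
  have hgm : ∀ k, Measurable (g k) := fun k => (Gr.measurable_closePairs _ _).mul_const _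
  have hsum : Summable fun k : ℕ => D * (((k + L : ℕ) : ℝ) + 1) * q ^ k := by
    have h1 := summable_pow_mul_geometric_of_norm_lt_one 1 (R := ℝ) (r := q)
      (by rwa [Real.norm_of_nonneg hq0.le])
    have h2 := summable_geometric_of_lt_one hq0.le hq1
    refine ((h1.mul_left D).add (h2.mul_left (D * (L + 1)))).congr fun k => ?_
    push_cast
    ring
  have hint : ∫⁻ V, ∑' k, g k V ∂(grMeasure h) ≠ ⊤ := by
    rw [lintegral_tsum fun k => (hgm k).aemeasurable]
    refine ne_top_of_le_ne_top hsum.tsum_ofReal_ne_top (ENNReal.tsum_le_tsum fun k => ?_)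
    rw [lintegral_mul_const _ (Gr.measurable_closePairs _ _)]
    have h1 := hE ((1 / 2) ^ k) (by positivity) (S k) (hSF k) (hne k) (hS k) (k + L)
      fun x hx y hy => by
        rw [pow_add, one_div, inv_pow, mul_comm, ← mul_assoc, inv_mul_cancel₀ (by positivity),
          one_mul]
        exact hL x (hSF k hx) y (hSF k hy)
    refine (mul_le_mul_left h1 _).trans_eq ?_
    rw [← ENNReal.ofReal_mul (by have := (hN k).le; positivity)]
    congr 1
    have := (hN k).ne'
    field_simp
  filter_upwards [ae_lt_top (Measurable.tsum hgm) hint] with V hV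
  refine ⟨(∑' k, g k V).toReal + 1, by positivity, fun k => ?_⟩
  have h1 : (g k V).toReal ≤ (∑' k, g k V).toReal :=
    ENNReal.toReal_mono hV.ne (ENNReal.le_tsum k)
  simp only [g] at h1
  rw [ENNReal.toReal_mul, ENNReal.toReal_natCast, ENNReal.toReal_ofReal (by
    have := (hN k).le; positivity), ← mul_div_assoc, div_le_iff₀ (hN k)] at h1
  rw [hqk]
  refine h1.trans (mul_le_mul_of_nonneg_right ?_ (hN k).le)
  simp only [g]
  linarith

/-- If `F` satisfies the Assouad bound with exponent `α ≥ m`, then almost every projection of `F`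
to an `m`-dimensional subspace has box dimensions at least `m / α` times those of `F`. -/
theorem ae_mul_boxDim_le_boxDim_proj (h : m ≤ n)
    {F : Set (EuclideanSpace ℝ (Fin n))} (hF : Bornology.IsBounded F) (hne : F.Nonempty)
    {α C : ℝ} (hC : 0 < C) (hα : 0 < α) (hmα : (m : ℝ) ≤ α)
    (hA : ∀ r R : ℝ, 0 < r → r < R → ∀ x ∈ F,
      (coverNum r (Metric.closedBall x R ∩ F) : ℝ) ≤ C * (R / r) ^ α) :
    ∀ᵐ V ∂(grMeasure h), m / α * upperBoxDim F ≤ upperBoxDim (V.proj F) ∧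
      m / α * lowerBoxDim F ≤ lowerBoxDim (V.proj F) := by
  -- Separation `2⁻ᵏ / 4` makes `S k` as large as the covering number at scale `2⁻ᵏ⁻¹`, which
  -- dominates `coverNum r F` for every `r` between `2⁻ᵏ⁻¹` and `2⁻ᵏ`.
  have hex := fun k : ℕ => exists_separated_coverNum_le hF
    (show (0 : ℝ) < (1 / 2) ^ k / 4 by positivity)
  choose S hSF hS hcard using hex
  have hSne : ∀ k, (S k).Nonempty := fun k =>
    Finset.card_pos.1 ((coverNum_pos hF hne (by positivity)).trans_le (hcard k))
  -- Countably many exponents `1 / (i + 1)` suffice, so one null set serves all `ε`.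
  have hae : ∀ᵐ V ∂(grMeasure h), ∀ i : ℕ, ∃ c : ℝ, 0 < c ∧ ∀ k,
      (Gr.closePairs V (S k) ((1 / 2) ^ k) : ℝ) * ((1 / 2) ^ k) ^ (1 / ((i : ℝ) + 1)) ≤
        c * ((S k).card : ℝ) ^ (2 - m / α) :=
    ae_all_iff.2 fun i => ae_exists_closePairs_le h hF hC hα hmα hA hSF hSne hS (by positivity)
  filter_upwards [hae] with V hV
  refine mul_boxDim_le_of_coverNum hF hne (V.isBounded_proj hF) (by positivity) fun ε hε => ?_
  obtain ⟨i, hi⟩ := exists_nat_one_div_lt hε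
  obtain ⟨c, hc, hk⟩ := hV i
  refine ⟨c⁻¹, by positivity, fun r hr hr1 => ?_⟩
  obtain ⟨k, hk1, hk2⟩ := exists_nat_pow_near_of_lt_one hr hr1.le
    (show (0 : ℝ) < 1 / 2 by norm_num) (by norm_num)
  have hρ : (0 : ℝ) < (1 / 2) ^ k := by positivity
  have h1 : coverNum r F ≤ (S k).card := by
    refine (coverNum_anti hF (by positivity) ?_).trans (hcard k)
    rw [pow_succ] at hk1
    linarith
  have h2 : coverNum ((1 / 2) ^ k) (V.proj F) ≤ coverNum r (V.proj F) :=
    coverNum_anti (V.isBounded_proj hF) hr hk2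
  have hN : (0 : ℝ) < (S k).card := by exact_mod_cast (hSne k).card_pos
  have h3 : ((S k).card : ℝ) ^ 2 ≤
      coverNum ((1 / 2) ^ k) (V.proj F) * Gr.closePairs V (S k) ((1 / 2) ^ k) := by
    exact_mod_cast V.card_sq_le_coverNum_proj hF hρ (hSF k)
  have h4 : r ^ ε ≤ ((1 / 2) ^ k) ^ (1 / ((i : ℝ) + 1)) :=
    (Real.rpow_le_rpow_of_exponent_ge hr hr1.le hi.le).trans
      (Real.rpow_le_rpow hr.le hk2 (by positivity))
  have h5 : ((S k).card : ℝ) ^ 2 =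
      ((S k).card : ℝ) ^ (m / α) * ((S k).card : ℝ) ^ (2 - m / α) := by
    rw [← Real.rpow_add hN, add_sub_cancel, ← Real.rpow_natCast, Nat.cast_ofNat]
  have h6 : r ^ ε * ((S k).card : ℝ) ^ (m / α) ≤ c * coverNum ((1 / 2) ^ k) (V.proj F) := by
    refine le_of_mul_le_mul_right (a := ((S k).card : ℝ) ^ (2 - m / α)) ?_ (by positivity)
    calc r ^ ε * ((S k).card : ℝ) ^ (m / α) * ((S k).card : ℝ) ^ (2 - m / α)
        = ((S k).card : ℝ) ^ 2 * r ^ ε := by rw [h5]; ring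
      _ ≤ (coverNum ((1 / 2) ^ k) (V.proj F) * Gr.closePairs V (S k) ((1 / 2) ^ k)) *
          ((1 / 2) ^ k) ^ (1 / ((i : ℝ) + 1)) := by gcongr
      _ ≤ coverNum ((1 / 2) ^ k) (V.proj F) * (c * ((S k).card : ℝ) ^ (2 - m / α)) := by
          rw [mul_assoc]
          exact mul_le_mul_of_nonneg_left (hk k) (by positivity)
      _ = _ := by ring
  rw [mul_assoc, inv_mul_le_iff₀ hc]
  calc r ^ ε * (coverNum r F : ℝ) ^ (m / α)
      ≤ r ^ ε * ((S k).card : ℝ) ^ (m / α) := by gcongr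
    _ ≤ c * coverNum ((1 / 2) ^ k) (V.proj F) := h6
    _ ≤ c * coverNum r (V.proj F) := by gcongr

end Projections

/-! ### Packing dimension of projections. -/

section Packing

/-- `S` is covered by countably many compact sets of upper box dimension at most `t`. -/
def CountablyCoveredByBoxDimLE {X : Type*} [PseudoMetricSpace X] (t : ℝ) (S : Set X) : Prop :=
  ∃ 𝒦 : Set (Set X), 𝒦.Countable ∧ (∀ K ∈ 𝒦, IsCompact K ∧ upperBoxDim K ≤ t) ∧ S ⊆ ⋃₀ 𝒦

namespace CountablyCoveredByBoxDimLE

variable {X : Type*} [PseudoMetricSpace X] {t : ℝ}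

theorem packingDim_le {S : Set X} (h : CountablyCoveredByBoxDimLE t S) (hS : S.Nonempty) :
    packingDim S ≤ t := by
  obtain ⟨𝒦, hc, hK, hcov⟩ := h
  have hne : 𝒦.Nonempty := by
    obtain ⟨x, hx⟩ := hS
    obtain ⟨K, hK, -⟩ := hcov hx
    exact ⟨K, hK⟩
  obtain ⟨K, rfl⟩ := hc.exists_eq_range hne
  unfold packingDim
  refine (csInf_le (a := ⨆ j, upperBoxDim (K j)) ?_ ?_).trans
    (ciSup_le fun j => (hK (K j) ⟨j, rfl⟩).2)
  swap
  · exact ⟨K, fun j => (hK (K j) ⟨j, rfl⟩).1, by rwa [← Set.sUnion_range], rfl⟩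
  refine ⟨0, ?_⟩
  rintro _ ⟨K, -, -, rfl⟩
  exact Real.iSup_nonneg fun j => upperBoxDim_nonneg _

theorem mono {S T : Set X} (h : CountablyCoveredByBoxDimLE t T) (hST : S ⊆ T) :
    CountablyCoveredByBoxDimLE t S := by
  obtain ⟨𝒦, hc, hK, hcov⟩ := h
  exact ⟨𝒦, hc, hK, hST.trans hcov⟩

theorem sUnion {𝒮 : Set (Set X)} (h𝒮 : 𝒮.Countable)
    (h : ∀ S ∈ 𝒮, CountablyCoveredByBoxDimLE t S) : CountablyCoveredByBoxDimLE t (⋃₀ 𝒮) := by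
  choose! 𝒦 hc hK hcov using h
  refine ⟨⋃ S ∈ 𝒮, 𝒦 S, h𝒮.biUnion hc, fun K hK' => ?_, Set.sUnion_subset fun S hS x hx => ?_⟩
  · obtain ⟨S, hS, hKS⟩ := Set.mem_iUnion₂.1 hK'
    exact hK S hS K hKS
  · obtain ⟨K, hKS, hxK⟩ := hcov S hS hx
    exact ⟨K, Set.mem_iUnion₂.2 ⟨S, hS, hKS⟩, hxK⟩

theorem union {S T : Set X} (hS : CountablyCoveredByBoxDimLE t S)
    (hT : CountablyCoveredByBoxDimLE t T) : CountablyCoveredByBoxDimLE t (S ∪ T) := by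
  rw [← Set.sUnion_pair]
  refine sUnion ((Set.countable_singleton T).insert S) ?_
  rintro _ (rfl | rfl) <;> assumption

theorem of_upperBoxDim_le {E : Type*} [NormedAddCommGroup E] [NormedSpace ℝ E]
    [FiniteDimensional ℝ E] {S : Set E} (hS : Bornology.IsBounded S) (h : upperBoxDim S ≤ t) :
    CountablyCoveredByBoxDimLE t S := by
  have : ProperSpace E := FiniteDimensional.proper ℝ E
  refine ⟨{closure S}, Set.countable_singleton _, ?_, by
    rw [Set.sUnion_singleton]; exact subset_closure⟩
  rintro _ rfl
  exact ⟨hS.isCompact_closure, by rwa [upperBoxDim_closure hS]⟩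

end CountablyCoveredByBoxDimLE

/-- The parametrization of a set `range f` of packing dimension larger than `t` can be restricted
to a closed set all of whose relatively open parts have images of large packing dimension. -/
theorem exists_isClosed_forall_not_countablyCovered {P X : Type*} [TopologicalSpace P]
    [SecondCountableTopology P] [PseudoMetricSpace X] {t : ℝ} {f : P → X}
    (h : ¬ CountablyCoveredByBoxDimLE t (Set.range f)) :
    ∃ Q : Set P, IsClosed Q ∧ Q.Nonempty ∧ ∀ W : Set P, IsOpen W → (W ∩ Q).Nonempty →
      ¬ CountablyCoveredByBoxDimLE t (f '' (W ∩ Q)) := by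
  let ℬ := TopologicalSpace.countableBasis P
  have hℬ : TopologicalSpace.IsTopologicalBasis ℬ := TopologicalSpace.isBasis_countableBasis P
  let 𝒰 : Set (Set P) := {b ∈ ℬ | CountablyCoveredByBoxDimLE t (f '' b)}
  have h𝒰 : CountablyCoveredByBoxDimLE t (f '' ⋃₀ 𝒰) := by
    rw [Set.sUnion_eq_biUnion, Set.image_iUnion₂, ← Set.sUnion_image]
    refine CountablyCoveredByBoxDimLE.sUnion
      (((TopologicalSpace.countable_countableBasis P).mono (Set.sep_subset _ _)).image _) ?_
    rintro _ ⟨b, hb, rfl⟩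
    exact hb.2
  refine ⟨(⋃₀ 𝒰)ᶜ, (isOpen_sUnion fun b hb => hℬ.isOpen hb.1).isClosed_compl, ?_,
    fun W hW ⟨x, hxW, hxQ⟩ hcov => ?_⟩
  · rw [Set.nonempty_compl]
    intro hu
    rw [hu, Set.image_univ] at h𝒰
    exact h h𝒰
  · obtain ⟨b, hb, hxb, hbW⟩ := hℬ.exists_subset_of_mem_open hxW hW
    -- The image of `b` is covered by those of `W ∩ Q` and of the removed set, so `b` would itself
    -- have been removed.
    refine hxQ ⟨b, ⟨hb, (hcov.union h𝒰).mono ?_⟩, hxb⟩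
    rw [← Set.image_union]
    refine Set.image_mono fun y hy => ?_
    by_cases hyQ : y ∈ ⋃₀ 𝒰
    · exact Or.inr hyQ
    · exact Or.inl ⟨hbW hy, hyQ⟩

/-- The null set must be fixed before the compact cover of `π_V F`, since there are uncountably many
covers; this is why the box result is applied to the countably many images `f '' (b ∩ Q)`. Baire's
theorem is used in the closed set `Q ⊆ ℕ → ℕ`, which is Polish although `F` need not be. -/
theorem ae_mul_le_packingDim_proj {n m : ℕ} (h : m ≤ n)
    {F : Set (EuclideanSpace ℝ (Fin n))} (hF : MeasurableSet F) (hne : F.Nonempty)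
    {α C : ℝ} (hC : 0 < C) (hα : 0 < α) (hmα : (m : ℝ) ≤ α)
    (hA : ∀ r R : ℝ, 0 < r → r < R → ∀ x ∈ F,
      (coverNum r (Metric.closedBall x R ∩ F) : ℝ) ≤ C * (R / r) ^ α)
    {t : ℝ} (ht : t < packingDim F) :
    ∀ᵐ V ∂(grMeasure h), m / α * t ≤ packingDim (V.proj F) := by
  obtain ⟨f, hf, rfl⟩ : ∃ f : (ℕ → ℕ) → EuclideanSpace ℝ (Fin n), Continuous f ∧
      Set.range f = F := by
    have h1 := hF.analyticSet
    rw [AnalyticSet] at h1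
    exact h1.resolve_left hne.ne_empty
  obtain ⟨Q, hQ, hQne, hQW⟩ := exists_isClosed_forall_not_countablyCovered (t := t) (f := f)
    fun hc => absurd (hc.packingDim_le hne) (not_le.2 ht)
  let ℬ := TopologicalSpace.countableBasis (ℕ → ℕ)
  have hℬ : TopologicalSpace.IsTopologicalBasis ℬ := TopologicalSpace.isBasis_countableBasis _
  have hae : ∀ᵐ V ∂(grMeasure h), ∀ b ∈ ℬ, (b ∩ Q).Nonempty →
      Bornology.IsBounded (f '' (b ∩ Q)) → m / α * t ≤ upperBoxDim (V.proj (f '' (b ∩ Q))) := by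
    refine (ae_ball_iff (TopologicalSpace.countable_countableBasis _)).2 fun b hb => ?_
    by_cases hbQ : (b ∩ Q).Nonempty
    swap
    · exact Eventually.of_forall fun V h1 => absurd h1 hbQ
    by_cases hbd : Bornology.IsBounded (f '' (b ∩ Q))
    swap
    · exact Eventually.of_forall fun V _ h1 => absurd h1 hbd
    have hbF : f '' (b ∩ Q) ⊆ Set.range f := Set.image_subset_range _ _
    have hlt : t < upperBoxDim (f '' (b ∩ Q)) := by
      by_contra! hle
      exact hQW b (hℬ.isOpen hb) hbQ (.of_upperBoxDim_le hbd hle)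
    have hA' : ∀ r R : ℝ, 0 < r → r < R → ∀ x ∈ f '' (b ∩ Q),
        (coverNum r (Metric.closedBall x R ∩ f '' (b ∩ Q)) : ℝ) ≤ C * (R / r) ^ α :=
      fun r R hr hR x hx => le_trans (by
        exact_mod_cast coverNum_mono (Metric.isBounded_closedBall.subset Set.inter_subset_left)
          (Set.inter_subset_inter_right _ hbF) hr) (hA r R hr hR x (hbF hx))
    filter_upwards [ae_mul_boxDim_le_boxDim_proj h hbd (hbQ.image f) hC hα hmα hA'] with V hV _ _
    exact (mul_le_mul_of_nonneg_left hlt.le (by positivity)).trans hV.1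
  filter_upwards [hae] with V hV
  -- The infimum over covers needs at least one cover: `V` is σ-compact.
  refine le_csInf ⟨_, compactCovering V.1, isCompact_compactCovering V.1, by
    rw [iUnion_compactCovering]; exact Set.subset_univ _, rfl⟩ ?_
  rintro _ ⟨K, hK, hcov, rfl⟩
  have hcont : Continuous fun x : Q => V.1.orthogonalProjectionOnto (f x) := by fun_prop
  have : Nonempty Q := hQne.to_subtype
  have : PolishSpace Q := hQ.polishSpace
  have : BaireSpace Q := by
    let _ := TopologicalSpace.upgradeIsCompletelyMetrizable Q
    infer_instance
  obtain ⟨j, ⟨x₀, hx₀⟩, hj⟩ := nonempty_interior_of_iUnion_of_closed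
    (f := fun j => (fun x : Q => V.1.orthogonalProjectionOnto (f x)) ⁻¹' K j)
    (fun j => (hK j).isClosed.preimage hcont) (by
      rw [← Set.preimage_iUnion, Set.eq_univ_iff_forall]
      exact fun x => hcov ⟨f x, ⟨x, rfl⟩, rfl⟩)
  obtain ⟨O, ⟨hOK, hO⟩, hxO⟩ := hj
  obtain ⟨W, hW, rfl⟩ := isOpen_induced_iff.1 hOK
  obtain ⟨b, hb, hxb, hbW⟩ := hℬ.exists_subset_of_mem_open
    -- Intersecting with the preimage of a ball makes the image of the piece bounded.
    (show x₀ ∈ W ∩ f ⁻¹' Metric.ball (f x₀) 1 from ⟨hxO, Metric.mem_ball_self one_pos⟩)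
    (hW.inter (Metric.isOpen_ball.preimage hf))
  have hbd : Bornology.IsBounded (f '' (b ∩ Q)) := by
    refine Metric.isBounded_ball.subset (?_ : _ ⊆ Metric.ball (f x₀) 1)
    rintro _ ⟨x, hx, rfl⟩
    exact (hbW hx.1).2
  have hsub : V.proj (f '' (b ∩ Q)) ⊆ K j := by
    rintro _ ⟨_, ⟨x, hx, rfl⟩, rfl⟩
    exact hO (show (⟨x, hx.2⟩ : Q) ∈ Subtype.val ⁻¹' W from (hbW hx.1).1)
  refine (hV b hb ⟨x₀, hxb, hx₀⟩ hbd).trans ((upperBoxDim_mono (hK j).isBounded hsub).trans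
    -- A uniform bound is required because the real supremum of an unbounded family is `0`.
    (le_ciSup (f := fun j => upperBoxDim (K j)) ⟨Module.finrank ℝ V.1 + 1, ?_⟩ j))
  rintro _ ⟨j, rfl⟩
  exact upperBoxDim_le_finrank_add_one (hK j).isBounded

end Packing

/-! ### Passage to the Assouad dimension and final algebra. -/

section Main

/-- Positivity excludes an empty set of exponents, whose infimum would be `0` by default. Raising
the exponent is harmless since `R / r > 1`. -/
theorem exists_assouad_bound_of_lt {X : Type*} [PseudoMetricSpace X] {F : Set X}
    (hpos : 0 < assouadDim F) {α : ℝ} (hα : assouadDim F < α) :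
    ∃ C : ℝ, 0 < C ∧ ∀ r R : ℝ, 0 < r → r < R → ∀ x ∈ F,
      (coverNum r (Metric.closedBall x R ∩ F) : ℝ) ≤ C * (R / r) ^ α := by
  obtain ⟨β, ⟨C, hC, hβ⟩, hβα⟩ := exists_lt_of_csInf_lt
    (Set.nonempty_iff_ne_empty.2 fun h0 => by
      rw [assouadDim, h0, Real.sInf_empty] at hpos
      exact hpos.false) hα
  refine ⟨C, hC, fun r R hr hR x hx => (hβ r R hr hR x hx).trans ?_⟩
  exact mul_le_mul_of_nonneg_left
    (Real.rpow_le_rpow_of_exponent_le ((one_le_div hr).2 hR.le) hβα.le) hC.le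

/-- The left side is the tangent at `A = m` to the convex function `A ↦ m * s / A`. -/
theorem sub_mul_div_le_div_mul {m A s : ℝ} (hm : 0 < m) (hA : m ≤ A) (hs : 0 ≤ s) :
    s - (A - m) * s / m ≤ m / A * s := by
  have hA0 : 0 < A := hm.trans_le hA
  have h1 : m / A * s - (s - (A - m) * s / m) = (A - m) ^ 2 * s / (m * A) := by
    field_simp
    ring
  have h2 : 0 ≤ (A - m) ^ 2 * s / (m * A) := by positivity
  linarith

theorem div_lt_sub_mul_div {m n A s : ℝ} (hm : 0 < m) (hmn : m < n) (hA : m ≤ A) (hs : 0 ≤ s)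
    (h : A < (m * n + 2 * s * (n - m)) * m / (m * n + s * (n - m))) :
    s / (1 + (1 / m - 1 / n) * s) < s - (A - m) * s / m := by
  have hn : 0 < n := hm.trans hmn
  have hnm : 0 < n - m := sub_pos.2 hmn
  have hD : 0 < m * n + s * (n - m) := by positivity
  rw [lt_div_iff₀ hD] at h
  -- For `s = 0` the hypothesis `h` would say `A < m`.
  have hs0 : 0 < s := by
    rcases hs.eq_or_lt with rfl | h0
    · have : m * (m * n) ≤ A * (m * n) := mul_le_mul_of_nonneg_right hA (by positivity)
      nlinarith
    · exact h0
  have h1 : s / (1 + (1 / m - 1 / n) * s) = s * (m * n) / (m * n + s * (n - m)) := by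
    have h2 : 1 + (1 / m - 1 / n) * s = (m * n + s * (n - m)) / (m * n) := by
      field_simp
    rw [h2, div_div_eq_mul_div]
  have h3 : s - (A - m) * s / m = s * (2 * m - A) / m := by
    field_simp
    ring
  rw [h1, h3, div_lt_div_iff₀ hD hm]
  nlinarith [mul_lt_mul_of_pos_left h hs0]

theorem div_mul_le_of_forall_nat {m A s d : ℝ} (hA : 0 < A)
    (h : ∀ i : ℕ, m / (A + 1 / ((i : ℝ) + 1)) * s ≤ d) : m / A * s ≤ d := by
  have h1 : Tendsto (fun i : ℕ => m / (A + 1 / ((i : ℝ) + 1)) * s) atTop (𝓝 (m / (A + 0) * s)) :=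
    ((tendsto_const_nhds.div (tendsto_const_nhds.add tendsto_one_div_add_atTop_nhds_zero_nat)
      (by rw [add_zero]; exact hA.ne')).mul_const s)
  rw [add_zero] at h1
  exact le_of_tendsto' h1 h

theorem ae_div_assouadDim_mul_boxDim_le {n m : ℕ} (hm : 1 ≤ m) (h : m ≤ n)
    {F : Set (EuclideanSpace ℝ (Fin n))} (hF : Bornology.IsBounded F) (hne : F.Nonempty)
    (hA : (m : ℝ) ≤ assouadDim F) :
    ∀ᵐ V ∂(grMeasure h), m / assouadDim F * upperBoxDim F ≤ upperBoxDim (V.proj F) ∧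
      m / assouadDim F * lowerBoxDim F ≤ lowerBoxDim (V.proj F) := by
  have hA0 : 0 < assouadDim F := lt_of_lt_of_le (by exact_mod_cast hm) hA
  have hae : ∀ᵐ V ∂(grMeasure h), ∀ i : ℕ,
      m / (assouadDim F + 1 / ((i : ℝ) + 1)) * upperBoxDim F ≤ upperBoxDim (V.proj F) ∧
      m / (assouadDim F + 1 / ((i : ℝ) + 1)) * lowerBoxDim F ≤ lowerBoxDim (V.proj F) := by
    refine ae_all_iff.2 fun i => ?_
    have hlt : assouadDim F < assouadDim F + 1 / ((i : ℝ) + 1) :=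
      lt_add_of_pos_right _ (by positivity)
    obtain ⟨C, hC, hCA⟩ := exists_assouad_bound_of_lt hA0 hlt
    exact ae_mul_boxDim_le_boxDim_proj h hF hne hC (hA0.trans hlt) (hA.trans hlt.le) hCA
  filter_upwards [hae] with V hV
  exact ⟨div_mul_le_of_forall_nat hA0 fun i => (hV i).1,
    div_mul_le_of_forall_nat hA0 fun i => (hV i).2⟩

theorem ae_div_assouadDim_mul_packingDim_le {n m : ℕ} (hm : 1 ≤ m) (h : m ≤ n)
    {F : Set (EuclideanSpace ℝ (Fin n))} (hF : MeasurableSet F) (hne : F.Nonempty)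
    (hA : (m : ℝ) ≤ assouadDim F) :
    ∀ᵐ V ∂(grMeasure h), m / assouadDim F * packingDim F ≤ packingDim (V.proj F) := by
  have hA0 : 0 < assouadDim F := lt_of_lt_of_le (by exact_mod_cast hm) hA
  -- Two countable approximations: `i` for exponents above the Assouad dimension, `k` for levels
  -- below the packing dimension.
  have hae : ∀ᵐ V ∂(grMeasure h), ∀ i k : ℕ,
      m / (assouadDim F + 1 / ((i : ℝ) + 1)) * (packingDim F - 1 / ((k : ℝ) + 1)) ≤
        packingDim (V.proj F) := by
    refine ae_all_iff.2 fun i => ae_all_iff.2 fun k => ?_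
    have hlt : assouadDim F < assouadDim F + 1 / ((i : ℝ) + 1) :=
      lt_add_of_pos_right _ (by positivity)
    obtain ⟨C, hC, hCA⟩ := exists_assouad_bound_of_lt hA0 hlt
    exact ae_mul_le_packingDim_proj h hF hne hC (hA0.trans hlt) (hA.trans hlt.le) hCA
      (sub_lt_self _ (by positivity))
  filter_upwards [hae] with V hV
  refine div_mul_le_of_forall_nat hA0 fun i => ?_
  have h1 : Tendsto (fun k : ℕ => m / (assouadDim F + 1 / ((i : ℝ) + 1)) *
      (packingDim F - 1 / ((k : ℝ) + 1))) atTop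
      (𝓝 (m / (assouadDim F + 1 / ((i : ℝ) + 1)) * (packingDim F - 0))) :=
    (tendsto_const_nhds.sub tendsto_one_div_add_atTop_nhds_zero_nat).const_mul _
  rw [sub_zero] at h1
  exact le_of_tendsto' h1 (hV i)

end Main

theorem corollary1p5 (n m : ℕ) (hm : 1 ≤ m) (hmn : m < n)
    (F : Set (EuclideanSpace ℝ (Fin n))) (hF : F.Nonempty) :
    (Bornology.IsBounded F → upperBoxDim F ≤ m → max (m : ℝ) (upperBoxDim F) ≤ assouadDim F →
      assouadDim F < (m * n + 2 * upperBoxDim F * (n - m)) * m /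
        (m * n + upperBoxDim F * (n - m)) →
      (∀ᵐ V ∂(grMeasure hmn.le),
        upperBoxDim F - (assouadDim F - m) * upperBoxDim F / m ≤ upperBoxDim (V.proj F)) ∧
      upperBoxDim F / (1 + (1 / m - 1 / n) * upperBoxDim F) <
        upperBoxDim F - (assouadDim F - m) * upperBoxDim F / m) ∧
    (Bornology.IsBounded F → lowerBoxDim F ≤ m → max (m : ℝ) (lowerBoxDim F) ≤ assouadDim F →
      assouadDim F < (m * n + 2 * lowerBoxDim F * (n - m)) * m /
        (m * n + lowerBoxDim F * (n - m)) →
      (∀ᵐ V ∂(grMeasure hmn.le),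
        lowerBoxDim F - (assouadDim F - m) * lowerBoxDim F / m ≤ lowerBoxDim (V.proj F)) ∧
      lowerBoxDim F / (1 + (1 / m - 1 / n) * lowerBoxDim F) <
        lowerBoxDim F - (assouadDim F - m) * lowerBoxDim F / m) ∧
    (MeasurableSet F → packingDim F ≤ m → max (m : ℝ) (packingDim F) ≤ assouadDim F →
      assouadDim F < (m * n + 2 * packingDim F * (n - m)) * m /
        (m * n + packingDim F * (n - m)) →
      (∀ᵐ V ∂(grMeasure hmn.le),
        packingDim F - (assouadDim F - m) * packingDim F / m ≤ packingDim (V.proj F)) ∧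
      packingDim F / (1 + (1 / m - 1 / n) * packingDim F) <
        packingDim F - (assouadDim F - m) * packingDim F / m) := by
  have hm0 : (0 : ℝ) < m := by exact_mod_cast hm
  have hmn' : (m : ℝ) < n := by exact_mod_cast hmn
  refine ⟨fun hb _ hA hlt => ?_, fun hb _ hA hlt => ?_, fun hF' _ hA hlt => ?_⟩
  · have hmA := (le_max_left _ _).trans hA
    have hs := upperBoxDim_nonneg F
    refine ⟨?_, div_lt_sub_mul_div hm0 hmn' hmA hs hlt⟩
    filter_upwards [ae_div_assouadDim_mul_boxDim_le hm hmn.le hb hF hmA] with V hV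
    exact (sub_mul_div_le_div_mul hm0 hmA hs).trans hV.1
  · have hmA := (le_max_left _ _).trans hA
    have hs := lowerBoxDim_nonneg hb
    refine ⟨?_, div_lt_sub_mul_div hm0 hmn' hmA hs hlt⟩
    filter_upwards [ae_div_assouadDim_mul_boxDim_le hm hmn.le hb hF hmA] with V hV
    exact (sub_mul_div_le_div_mul hm0 hmA hs).trans hV.2
  · have hmA := (le_max_left _ _).trans hA
    have hs := packingDim_nonneg F
    refine ⟨?_, div_lt_sub_mul_div hm0 hmn' hmA hs hlt⟩
    filter_upwards [ae_div_assouadDim_mul_packingDim_le hm hmn.le hF' hF hmA] with V hV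
    exact (sub_mul_div_le_div_mul hm0 hmA hs).trans hV
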